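/- Let $\mathcal H$ be a real Hilbert space, $\mathcal G$ a real normed space, $\mathcal D\subset\mathcal G$ (with the topology induced by $\mathcal G$) and $\bar p\in\mathcal D$. Let $I_1,I_2$ be disjoint finite index sets with $I_1\cup I_2\neq\emptyset$, and let $f_i:\mathcal D\to\mathbb R$, $g_i:\mathcal D\to\mathcal H$, $i\in I_1\cup I_2$, be locally Lipschitz on $\mathcal D$. For $p\in\mathcal D$ put $$C(p)=\{x\in\mathcal H : \langle x\mid g_i(p)\rangle=f_i(p)\ (i\in I_1),\ \langle x\mid g_i(p)\rangle\le f_i(p)\ (i\in I_2)\},$$ let $P(v,p)$ denote the metric projection of $v\in\mathcal H$ onto $C(p)$ (defined whenever $C(p)\ne\emptyset$), and let $I_p(x)=\{i\in I_1\cup I_2:\langle x\mid g_i(p)\rangle=f_i(p)\}$. Let $C(\bar p)\neq\emptyset$, $\bar v\in\mathcal H\setminus C(\bar p)$, $\bar x=P(\bar v,\bar p)$, and suppose that $$\bar v-\bar x=\sum_{i\in I_1\cup\bar K}\bar\lambda_i g_i(\bar p),\qquad \bar\lambda_i>0\ (i\in\bar K),\qquad \bar K\subset I_{\bar p}(\bar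 x)\cap I_2,$$ where $g_i(\bar p)$, $i\in I_1\cup\bar K$, are linearly independent. For finite $L\subset I_2\setminus\bar K$ let $$C_{\bar K,L}(p)=\{x : \langle x\mid g_i(p)\rangle=f_i(p)\ (i\in I_1\cup\bar K\cup L),\ \langle x\mid g_i(p)\rangle\le f_i(p)\ (i\in I_2\setminus(\bar K\cup L))\}.$$ Assume that 1. the relaxed constant rank constraint qualification (RCRCQ) holds at $(\bar p,\bar x)$: there is a neighbourhood $U_0$ of $\bar p$ in $\mathcal D$ such that for every $J$ with $I_1\subset J\subset I_{\bar p}(\bar x)$ and every $p\in U_0$, $\operatorname{rank}\{g_i(p):i\in J\}=\operatorname{rank}\{g_i(\bar p):i\in J\}$; 2. for every (possibly empty) $L\subset(I_{\bar p}(\bar x)\cap I_2)\setminus\bar K$ such that $g_i(\bar p)$, $i\in I_1\cup\bar K\cup L$, are linearly independent, the Mangasarian–Fromovitz constraint qualification (MFCQ) holds for $C_{\bar K,L}(\bar p)$ at $\bar x$: the vectors $g_i(\bar p)$, $i\in I_1\cup\bar K\cup L$, are linearly independent and there is $h\in\mathcal H$ with $\langle g_i(\bar p)\mid h\rangle=0$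 for $i\in I_1\cup\bar K\cup L$ and $\langle g_i(\bar p)\mid h\rangle<0$ for $i\in I_{\bar p}(\bar x)\cap I_2\setminus(\bar K\cup L)$. Then there exist a neighbourhood $W$ of $\bar v$ in $\mathcal H$, a neighbourhood $U$ of $\bar p$ in $\mathcal D$ and a constant $\ell^0>0$ such that $C(p)\ne\emptyset$ for all $p\in U$ (so that $P$ is defined on $W\times U$) and $$\|(v_1-v_2)-2[P(v_1,p_1)-P(v_2,p_2)]\|\le\|v_1-v_2\|+\ell^0\|p_1-p_2\|$$ for all $(v_1,p_1),(v_2,p_2)\in W\times U$. -/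

import Mathlib

open Topology
open scoped InnerProductSpace

namespace ParamProj

variable {X H ι : Type*} [NormedAddCommGroup H] [InnerProductSpace ℝ H]

/-- The polyhedral set of all `x` with `⟪x, g i p⟫ = f i p` for `i ∈ E` and
`⟪x, g i p⟫ ≤ f i p` for `i ∈ I`. -/
def feasibleSet (g : ι → X → H) (f : ι → X → ℝ) (E I : Finset ι) (p : X) : Set H :=
  {x | (∀ i ∈ E, ⟪x, g i p⟫_ℝ = f i p) ∧ ∀ i ∈ I, ⟪x, g i p⟫_ℝ ≤ f i p}

/-- The indices in `E ∪ I` whose constraint holds with equality at `x` for the parameter `p`. -/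
def activeSet (g : ι → X → H) (f : ι → X → ℝ) (E I : Finset ι) (p : X) (x : H) : Set ι :=
  {i | (i ∈ E ∨ i ∈ I) ∧ ⟪x, g i p⟫_ℝ = f i p}

/-- `x` solves the problem: minimize `‖y - v‖ ^ 2 / 2` subject to `y ∈ S`. -/
def IsProjection (S : Set H) (v x : H) : Prop :=
  x ∈ S ∧ IsMinOn (fun y => (1 / 2 : ℝ) * ‖y - v‖ ^ 2) S x

/-- The metric projection of `v` onto `S`: the unique solution of the above problem when `S` is a
nonempty closed convex subset of a Hilbert space (an arbitrary value when no solution exists). -/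
noncomputable def proj (S : Set H) (v : H) : H :=
  Classical.epsilon (IsProjection S v)

/-- Relaxed constant rank constraint qualification at `(p, x)`, for the set-valued map
`feasibleSet g f E I`. -/
def RCRCQ [TopologicalSpace X] (g : ι → X → H) (f : ι → X → ℝ) (E I : Finset ι)
    (p : X) (x : H) : Prop :=
  x ∈ feasibleSet g f E I p ∧
    ∃ U ∈ 𝓝 p, ∀ J : Finset ι, E ⊆ J → (J : Set ι) ⊆ activeSet g f E I p x →
      ∀ q ∈ U, Module.finrank ℝ (Submodule.span ℝ ((fun i => g i q) '' (J : Set ι))) =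
        Module.finrank ℝ (Submodule.span ℝ ((fun i => g i p) '' (J : Set ι)))

/-- Mangasarian-Fromovitz constraint qualification at `x`, for the set `feasibleSet g f E I p`. -/
def MFCQ (g : ι → X → H) (f : ι → X → ℝ) (E I : Finset ι) (p : X) (x : H) : Prop :=
  x ∈ feasibleSet g f E I p ∧ LinearIndepOn ℝ (fun i => g i p) (E : Set ι) ∧
    ∃ h : H, (∀ i ∈ E, ⟪g i p, h⟫_ℝ = 0) ∧
      ∀ i ∈ I, i ∈ activeSet g f E I p x → ⟪g i p, h⟫_ℝ < 0

end ParamProj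

/-! Insert `P (v₂, p₁)` between the two projections. For fixed `p₁` the map `v ↦ v - 2 P(v, p₁)` is
nonexpansive, because projections onto convex sets are firmly nonexpansive
(`IsNearest.norm_reflection_le`); this gives the coefficient exactly `1` of `‖v₁ - v₂‖`. What
remains is twice a Lipschitz estimate of `p ↦ P(v, p)`, uniform in `v` near `vbar`.

MFCQ with `L = ∅` yields feasible points near `xbar` for nearby parameters, and the multiplier
representation of `vbar - xbar` then makes `P` continuous at `(vbar, pbar)`
(`tendsto_proj_feasibleSet`). Constraints inactive at `xbar` therefore stay inactive and can be
dropped. By RCRCQ, a subfamily of active normals containing the equality normals that is independent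
at a nearby `p` is already independent at `pbar`. There are finitely many such families, so one
constant `c` quantifies their independence at all nearby parameters.

The Lipschitz estimate is `norm_sub_le_of_data_perturbation`. The projection at `p₁` has a
multiplier with independent support `J` (`IsNearest.exists_isKKT`). Solving the equality system on
`J` with the data of `p₂` gives a nearby point `w` (`norm_sub_le_of_common_support`), which may
slightly violate other constraints and have slightly negative multipliers. It is nevertheless the
exact projection of a shifted point onto a relaxed polyhedron. The shift is harmless by
nonexpansiveness. The relaxation is handled by `norm_sub_le_of_relaxation`: along a segment of
right-hand sides the projection is continuous, and Lipschitz on each set of times sharing one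
support. Finitely many supports occur, so it is Lipschitz overall
(`norm_sub_le_of_finite_partition`). -/

namespace ParamProj

/-! ### Nearest points of convex sets and firm nonexpansiveness -/

section Projection

variable {H : Type*} [NormedAddCommGroup H] [InnerProductSpace ℝ H]

/-- The variational characterization of the nearest point of a convex set `S` to `v`. -/
def IsNearest (S : Set H) (v x : H) : Prop :=
  x ∈ S ∧ ∀ y ∈ S, ⟪v - x, y - x⟫_ℝ ≤ 0

/-- Add the two variational inequalities, each tested at the other nearest point. -/
theorem IsNearest.norm_sub_sq_le {S : Set H} {v₁ v₂ x₁ x₂ : H} (h₁ : IsNearest S v₁ x₁)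
    (h₂ : IsNearest S v₂ x₂) : ‖x₁ - x₂‖ ^ 2 ≤ ⟪v₁ - v₂, x₁ - x₂⟫_ℝ := by
  have a := h₁.2 x₂ h₂.1
  have b := h₂.2 x₁ h₁.1
  rw [← real_inner_self_eq_norm_sq]
  simp only [inner_sub_left, inner_sub_right] at *
  linarith

theorem IsNearest.norm_sub_le {S : Set H} {v₁ v₂ x₁ x₂ : H} (h₁ : IsNearest S v₁ x₁)
    (h₂ : IsNearest S v₂ x₂) : ‖x₁ - x₂‖ ≤ ‖v₁ - v₂‖ := by
  have a := h₁.norm_sub_sq_le h₂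
  have b := real_inner_le_norm (v₁ - v₂) (x₁ - x₂)
  by_contra! hc
  nlinarith [norm_nonneg (v₁ - v₂)]

theorem IsNearest.unique {S : Set H} {v x₁ x₂ : H} (h₁ : IsNearest S v x₁)
    (h₂ : IsNearest S v x₂) : x₁ = x₂ := by
  have := h₁.norm_sub_le h₂
  rw [sub_self, norm_zero] at this
  exact sub_eq_zero.1 (norm_le_zero_iff.1 this)

/-- With `a = v₁ - v₂` and `b = x₁ - x₂`, `‖a - 2b‖² = ‖a‖² - 4(⟪a, b⟫ - ‖b‖²)`, and the bracket is
nonnegative by firm nonexpansiveness. -/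
theorem IsNearest.norm_reflection_le {S : Set H} {v₁ v₂ x₁ x₂ : H} (h₁ : IsNearest S v₁ x₁)
    (h₂ : IsNearest S v₂ x₂) : ‖(v₁ - v₂) - (2 : ℝ) • (x₁ - x₂)‖ ≤ ‖v₁ - v₂‖ := by
  have a := h₁.norm_sub_sq_le h₂
  refine (sq_le_sq₀ (norm_nonneg _) (norm_nonneg _)).1 ?_
  rw [norm_sub_sq_real, norm_smul, real_inner_smul_right, mul_pow, Real.norm_ofNat]
  linarith

theorem IsNearest.norm_sub_le_of_mem {S : Set H} {v x y : H} (h : IsNearest S v x) (hy : y ∈ S) :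
    ‖v - x‖ ≤ ‖v - y‖ := by
  have a := h.2 y hy
  have b : ‖v - y‖ ^ 2 = ‖v - x‖ ^ 2 - 2 * ⟪v - x, y - x⟫_ℝ + ‖y - x‖ ^ 2 := by
    rw [← norm_sub_sq_real]; congr 2; abel
  refine (sq_le_sq₀ (norm_nonneg _) (norm_nonneg _)).1 ?_
  nlinarith [sq_nonneg ‖y - x‖]

theorem isProjection_iff_isNearest {S : Set H} (hS : Convex ℝ S) {v x : H} :
    IsProjection S v x ↔ IsNearest S v x := by
  constructor
  · rintro ⟨hx, hmin⟩
    refine ⟨hx, (norm_eq_iInf_iff_real_inner_le_zero hS hx).1 ?_⟩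
    have : Nonempty S := ⟨⟨x, hx⟩⟩
    refine le_antisymm (le_ciInf fun y => ?_) (ciInf_le ⟨0, ?_⟩ (⟨x, hx⟩ : S))
    · have := hmin y.2
      simp only [Set.mem_ofPred_eq] at this
      rw [norm_sub_rev v x, norm_sub_rev v y]
      exact (sq_le_sq₀ (norm_nonneg _) (norm_nonneg _)).1 (by linarith)
    · rintro _ ⟨y, rfl⟩
      exact norm_nonneg _
  · intro h
    refine ⟨h.1, fun y hy => ?_⟩
    have := h.norm_sub_le_of_mem hy
    simp only [Set.mem_ofPred_eq]
    rw [norm_sub_rev x, norm_sub_rev y]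
    gcongr

theorem isNearest_proj [CompleteSpace H] {S : Set H} (hS : Convex ℝ S) (hc : IsClosed S)
    (hne : S.Nonempty) (v : H) : IsNearest S v (proj S v) := by
  obtain ⟨x, hx, hmin⟩ := exists_norm_eq_iInf_of_complete_convex hne hc.isComplete hS v
  have h : IsProjection S v x :=
    (isProjection_iff_isNearest hS).2 ⟨hx, (norm_eq_iInf_iff_real_inner_le_zero hS hx).1 hmin⟩
  exact (isProjection_iff_isNearest hS).1 (Classical.epsilon_spec (p := IsProjection S v) ⟨x, h⟩)

end Projection

/-! ### Polyhedra, finitely generated cones and multipliers with independent support -/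

section Polyhedron

variable {H ι : Type*} [NormedAddCommGroup H] [InnerProductSpace ℝ H]

/-- The polyhedron of all `x` with `⟪x, g i⟫ = f i` for `i ∈ E` and `⟪x, g i⟫ ≤ f i` for
`i ∈ I`. -/
def polyhedron (g : ι → H) (f : ι → ℝ) (E I : Finset ι) : Set H :=
  {x | (∀ i ∈ E, ⟪x, g i⟫_ℝ = f i) ∧ ∀ i ∈ I, ⟪x, g i⟫_ℝ ≤ f i}

theorem convex_polyhedron (g : ι → H) (f : ι → ℝ) (E I : Finset ι) :
    Convex ℝ (polyhedron g f E I) := by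
  intro x hx y hy a b ha hb hab
  refine ⟨fun i hi => ?_, fun i hi => ?_⟩
  · rw [inner_add_left, real_inner_smul_left, real_inner_smul_left, hx.1 i hi, hy.1 i hi,
      ← add_mul, hab, one_mul]
  · rw [inner_add_left, real_inner_smul_left, real_inner_smul_left]
    calc a * ⟪x, g i⟫_ℝ + b * ⟪y, g i⟫_ℝ ≤ a * f i + b * f i := by
          gcongr
          exacts [hx.2 i hi, hy.2 i hi]
      _ = f i := by rw [← add_mul, hab, one_mul]

theorem isClosed_polyhedron (g : ι → H) (f : ι → ℝ) (E I : Finset ι) :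
    IsClosed (polyhedron g f E I) := by
  have : polyhedron g f E I =
      (⋂ i ∈ E, {x | ⟪x, g i⟫_ℝ = f i}) ∩ ⋂ i ∈ I, {x | ⟪x, g i⟫_ℝ ≤ f i} := by
    ext x; simp [polyhedron]
  rw [this]
  refine (isClosed_biInter fun i _ => isClosed_eq (by fun_prop) continuous_const).inter
    (isClosed_biInter fun i _ => isClosed_le (by fun_prop) continuous_const)

/-- `lam` is a multiplier with linearly independent support `J`, in the Karush-Kuhn-Tucker system of
the projection `x` of `v` onto `polyhedron g f E I`. -/
structure IsKKT (g : ι → H) (f : ι → ℝ) (E I J : Finset ι) (v x : H) (lam : ι → ℝ) : Prop where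
  mem : x ∈ polyhedron g f E I
  subset : E ⊆ J
  active : ∀ i ∈ J, ⟪x, g i⟫_ℝ = f i
  mem_of_notMem : ∀ i ∈ J, i ∉ E → i ∈ I
  nonneg : ∀ i ∈ J, i ∉ E → 0 ≤ lam i
  linInd : LinearIndepOn ℝ g (J : Set ι)
  sum_eq : v - x = ∑ i ∈ J, lam i • g i

/-- A multiplier rule is sufficient for being the nearest point. -/
theorem isNearest_of_multiplier {g : ι → H} {f : ι → ℝ} {E I J : Finset ι} {v x : H} {lam : ι → ℝ}
    (mem : x ∈ polyhedron g f E I) (active : ∀ i ∈ J, ⟪x, g i⟫_ℝ = f i)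
    (hJ : ∀ i ∈ J, i ∉ E → i ∈ I ∧ 0 ≤ lam i) (sum_eq : v - x = ∑ i ∈ J, lam i • g i) :
    IsNearest (polyhedron g f E I) v x := by
  refine ⟨mem, fun y hy => ?_⟩
  rw [sum_eq, sum_inner]
  refine Finset.sum_nonpos fun i hi => ?_
  rw [real_inner_smul_left, inner_sub_right, real_inner_comm, real_inner_comm x, active i hi]
  by_cases hE : i ∈ E
  · rw [hy.1 i hE]; simp
  · exact mul_nonpos_of_nonneg_of_nonpos (hJ i hi hE).2
      (by linarith [hy.2 i (hJ i hi hE).1])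

theorem IsKKT.isNearest {g : ι → H} {f : ι → ℝ} {E I J : Finset ι} {v x : H} {lam : ι → ℝ}
    (h : IsKKT g f E I J v x lam) : IsNearest (polyhedron g f E I) v x :=
  isNearest_of_multiplier h.mem h.active
    (fun i hi hE => ⟨h.mem_of_notMem i hi hE, h.nonneg i hi hE⟩) h.sum_eq

/-- Conic Carathéodory theorem, retaining a linearly independent family of free generators. -/
theorem exists_linearIndepOn_conic_combination [DecidableEq ι] (g : ι → H) {E : Finset ι}
    (hE : LinearIndepOn ℝ g (E : Set ι)) (J : Finset ι) (hEJ : E ⊆ J) (lam : ι → ℝ)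
    (hlam : ∀ i ∈ J, i ∉ E → 0 ≤ lam i) :
    ∃ (J' : Finset ι) (lam' : ι → ℝ), E ⊆ J' ∧ J' ⊆ J ∧ LinearIndepOn ℝ g (J' : Set ι) ∧
      (∀ i ∈ J', i ∉ E → 0 ≤ lam' i) ∧ ∑ i ∈ J', lam' i • g i = ∑ i ∈ J, lam i • g i := by
  induction J using Finset.strongInduction generalizing lam with
  | H J ih =>
    by_cases hJ : LinearIndepOn ℝ g (J : Set ι)
    · exact ⟨J, lam, hEJ, subset_rfl, hJ, hlam, rfl⟩
    -- A linear dependence must involve an index outside `E`, since `E` is independent; changing its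
    -- sign makes that coefficient positive.
    obtain ⟨c, hc, i₀, hi₀, hiE₀, hci₀⟩ : ∃ c : ι → ℝ, ∑ i ∈ J, c i • g i = 0 ∧
        ∃ i ∈ J, i ∉ E ∧ 0 < c i := by
      rw [linearIndepOn_finset_iff] at hJ
      push Not at hJ
      obtain ⟨c, hc, i₁, hi₁, hne₁⟩ := hJ
      have : ∃ i ∈ J, i ∉ E ∧ c i ≠ 0 := by
        by_contra! hcon
        have h0 : ∑ i ∈ E, c i • g i = 0 := by
          rw [← hc]
          refine Finset.sum_subset hEJ fun i hi hiE => ?_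
          rw [hcon i hi hiE, zero_smul]
        by_cases hiE : i₁ ∈ E
        · exact hne₁ (linearIndepOn_finset_iff.1 hE c h0 i₁ hiE)
        · exact hne₁ (hcon i₁ hi₁ hiE)
      obtain ⟨i, hi, hiE, hne⟩ := this
      rcases lt_or_gt_of_ne hne with h | h
      · refine ⟨fun i => -c i, ?_, i, hi, hiE, by simpa using h⟩
        simp [hc]
      · exact ⟨c, hc, i, hi, hiE, h⟩
    -- The minimal ratio is the largest multiple of `c` that can be subtracted with all constrained
    -- coefficients staying nonnegative; it annihilates coefficient `k`.
    obtain ⟨k, hk, hmin⟩ := Finset.exists_min_image (J.filter fun i => i ∉ E ∧ 0 < c i)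
      (fun i => lam i / c i) ⟨i₀, by simp [hi₀, hiE₀, hci₀]⟩
    simp only [Finset.mem_filter] at hk hmin
    obtain ⟨hkJ, hkE, hck⟩ := hk
    have hlk : (lam k - lam k / c k * c k) = 0 := by field_simp; ring
    obtain ⟨J', lam', h1, h2, h3, h4, h5⟩ := ih (J.erase k) (Finset.erase_ssubset hkJ)
      (fun i hi => Finset.mem_erase.2 ⟨fun h => hkE (h ▸ hi), hEJ hi⟩)
      (fun i => lam i - lam k / c k * c i) (fun i hi hiE => by
        have hiJ := Finset.mem_of_mem_erase hi
        have hk0 : 0 ≤ lam k / c k := div_nonneg (hlam k hkJ hkE) hck.le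
        rcases le_or_gt (c i) 0 with h | h
        · have := mul_nonpos_of_nonneg_of_nonpos hk0 h
          linarith [hlam i hiJ hiE]
        · have := hmin i ⟨hiJ, hiE, h⟩
          rw [le_div_iff₀ h] at this
          linarith)
    refine ⟨J', lam', h1, h2.trans (Finset.erase_subset _ _), h3, h4, h5.trans ?_⟩
    have e : ∑ i ∈ J.erase k, (lam i - lam k / c k * c i) • g i =
        ∑ i ∈ J, (lam i - lam k / c k * c i) • g i :=
      Finset.sum_erase _ (by rw [hlk, zero_smul])
    rw [e]
    simp only [sub_smul, mul_smul, Finset.sum_sub_distrib, ← Finset.smul_sum, hc]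
    simp

/-- The cone generated by `±g i`, `i ∈ E`, and `g i`, `i ∈ J \ E`. -/
def conicSpan (g : ι → H) (E J : Finset ι) : Set H :=
  {w | ∃ lam : ι → ℝ, (∀ i ∈ J, i ∉ E → 0 ≤ lam i) ∧ w = ∑ i ∈ J, lam i • g i}

theorem convex_conicSpan (g : ι → H) (E J : Finset ι) : Convex ℝ (conicSpan g E J) := by
  rintro _ ⟨l, hl, rfl⟩ _ ⟨m, hm, rfl⟩ a b ha hb -
  refine ⟨fun i => a * l i + b * m i, fun i hi hE => ?_, ?_⟩
  · have := hl i hi hE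
    have := hm i hi hE
    positivity
  · simp only [add_smul, mul_smul, Finset.sum_add_distrib, Finset.smul_sum]

/-- Independence makes the cone the image of a closed set of coefficients under an injective linear
map from a finite-dimensional space, which is a closed embedding. -/
theorem isClosed_conicSpan_of_linearIndepOn {g : ι → H} (E : Finset ι) {J : Finset ι}
    (hJ : LinearIndepOn ℝ g (J : Set ι)) : IsClosed (conicSpan g E J) := by
  classical
  let T : (J → ℝ) →ₗ[ℝ] H := Fintype.linearCombination ℝ (fun i : J => g i)
  have hT : LinearMap.ker T = ⊥ :=
    LinearMap.ker_eq_bot.2 (hJ.fintypeLinearCombination_injective)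
  have key : conicSpan g E J = T '' {m | ∀ i : J, (i : ι) ∉ E → 0 ≤ m i} := by
    ext w
    constructor
    · rintro ⟨l, hl, rfl⟩
      refine ⟨fun i => l i, fun i hE => hl i i.2 hE, ?_⟩
      simp only [T, Fintype.linearCombination_apply]
      exact Finset.sum_coe_sort J fun i => l i • g i
    · rintro ⟨m, hm, rfl⟩
      refine ⟨fun i => if h : i ∈ J then m ⟨i, h⟩ else 0, fun i hi hE => ?_, ?_⟩
      · simpa [hi] using hm ⟨i, hi⟩ hE
      · simp only [T, Fintype.linearCombination_apply]
        rw [← Finset.sum_coe_sort J]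
        simp
  rw [key]
  refine (LinearMap.isClosedEmbedding_of_injective hT).isClosedMap _ ?_
  simp only [Set.ofPred_forall]
  exact isClosed_iInter fun i => isClosed_iInter fun _ => isClosed_le continuous_const
    (continuous_apply i)

/-- By Carathéodory the cone is a finite union of cones over independent subfamilies. -/
theorem isClosed_conicSpan {g : ι → H} {E J : Finset ι} (hE : LinearIndepOn ℝ g (E : Set ι))
    (hEJ : E ⊆ J) : IsClosed (conicSpan g E J) := by
  classical
  have key : conicSpan g E J = ⋃ J' ∈ {J' | J' ∈ J.powerset ∧ E ⊆ J' ∧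
      LinearIndepOn ℝ g (J' : Set ι)}, conicSpan g E J' := by
    ext w
    simp only [Set.mem_iUnion, Set.mem_ofPred_eq, Finset.mem_powerset, exists_prop]
    constructor
    · rintro ⟨l, hl, rfl⟩
      obtain ⟨J', l', h1, h2, h3, h4, h5⟩ :=
        exists_linearIndepOn_conic_combination g hE J hEJ l hl
      exact ⟨J', ⟨h2, h1, h3⟩, l', h4, h5.symm⟩
    · rintro ⟨J', ⟨h2, -, -⟩, l, hl, rfl⟩
      refine ⟨fun i => if i ∈ J' then l i else 0, fun i _ hiE => ?_, ?_⟩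
      · dsimp only
        split_ifs with h
        exacts [hl i h hiE, le_rfl]
      · simp only [ite_smul, zero_smul, ← Finset.sum_filter]
        congr 1
        ext i
        simpa using @h2 i
  rw [key]
  exact Set.Finite.isClosed_biUnion (J.powerset.finite_toSet.subset fun J' h => h.1)
    fun J' h => isClosed_conicSpan_of_linearIndepOn E h.2.2

/-- Necessity of the multiplier rule, with a linearly independent support. -/
theorem IsNearest.exists_isKKT [CompleteSpace H] [DecidableEq ι] {g : ι → H} {f : ι → ℝ}
    {E I : Finset ι} {v x : H} (hE : LinearIndepOn ℝ g (E : Set ι))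
    (h : IsNearest (polyhedron g f E I) v x) :
    ∃ J lam, IsKKT g f E I J v x lam := by
  obtain ⟨hx, hvi⟩ := h
  set A := E ∪ I.filter (fun i => ⟪x, g i⟫_ℝ = f i) with hA
  have hEA : E ⊆ A := Finset.subset_union_left
  have hact : ∀ i ∈ A, ⟪x, g i⟫_ℝ = f i := by
    intro i hi
    rcases Finset.mem_union.1 hi with h | h
    exacts [hx.1 i h, (Finset.mem_filter.1 h).2]
  have hmemI : ∀ i ∈ A, i ∉ E → i ∈ I := by
    intro i hi hiE
    rcases Finset.mem_union.1 hi with h | h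
    exacts [absurd h hiE, (Finset.mem_filter.1 h).1]
  have hcl := isClosed_conicSpan hE hEA
  have hne : (conicSpan g E A).Nonempty := ⟨0, 0, by simp, by simp⟩
  -- Project `v - x` onto the cone of active normals. The residual `d` turns out to be a feasible
  -- direction at `x` with `⟪v - x, d⟫ = ‖d‖²`, which forces `d = 0`.
  obtain ⟨⟨l, hl, hw⟩, hmin⟩ := isNearest_proj (convex_conicSpan g E A) hcl hne (v - x)
  set w := proj (conicSpan g E A) (v - x)
  set d := v - x - w with hd
  -- shifting one coefficient of `w` stays in the cone
  have hshift : ∀ i ∈ A, ∀ t : ℝ, (i ∉ E → 0 ≤ l i + t) → t * ⟪d, g i⟫_ℝ ≤ 0 := by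
    intro i hi t ht
    have hmem : w + t • g i ∈ conicSpan g E A := by
      refine ⟨fun j => l j + if j = i then t else 0, fun j hj hjE => ?_, ?_⟩
      · dsimp only
        split_ifs with hji
        · subst hji; exact ht hjE
        · simpa using hl j hj hjE
      · simp [add_smul, Finset.sum_add_distrib, hw, hi]
    have := hmin _ hmem
    rwa [add_sub_cancel_left, real_inner_smul_right] at this
  have hdE : ∀ i ∈ E, ⟪d, g i⟫_ℝ = 0 := by
    intro i hi
    have a := hshift i (hEA hi) 1 (fun h => absurd hi h)
    have b := hshift i (hEA hi) (-1) (fun h => absurd hi h)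
    linarith
  have hdI : ∀ i ∈ A, i ∉ E → ⟪d, g i⟫_ℝ ≤ 0 := by
    intro i hi hiE
    have := hshift i hi 1 (fun h => by linarith [hl i hi h])
    linarith
  have hdw : ⟪d, w⟫_ℝ = 0 := by
    rw [hw, inner_sum]
    refine Finset.sum_eq_zero fun i hi => ?_
    rw [real_inner_smul_right]
    by_cases hiE : i ∈ E
    · rw [hdE i hiE, mul_zero]
    · have a := hshift i hi (-l i) (fun _ => by simp)
      have b := mul_nonpos_of_nonneg_of_nonpos (hl i hi hiE) (hdI i hi hiE)
      linarith
  -- a small step in direction `d` is feasible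
  have hstep : ∀ᶠ t : ℝ in 𝓝[>] 0, x + t • d ∈ polyhedron g f E I := by
    have hI : ∀ i ∈ I, ∀ᶠ t : ℝ in 𝓝[>] 0, ⟪x + t • d, g i⟫_ℝ ≤ f i := by
      intro i hi
      by_cases hiA : i ∈ A
      · filter_upwards [self_mem_nhdsWithin] with t ht
        rw [inner_add_left, real_inner_smul_left, hact i hiA]
        have hle : ⟪d, g i⟫_ℝ ≤ 0 := by
          by_cases hiE : i ∈ E
          exacts [(hdE i hiE).le, hdI i hiA hiE]
        have := mul_nonpos_of_nonneg_of_nonpos (le_of_lt (Set.mem_Ioi.1 ht)) hle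
        linarith
      · have hlt : ⟪x, g i⟫_ℝ < f i := by
          refine lt_of_le_of_ne (hx.2 i hi) fun he => hiA ?_
          exact Finset.mem_union_right _ (Finset.mem_filter.2 ⟨hi, he⟩)
        have hc : Filter.Tendsto (fun t : ℝ => ⟪x + t • d, g i⟫_ℝ) (𝓝 0) (𝓝 ⟪x, g i⟫_ℝ) := by
          have : Continuous fun t : ℝ => ⟪x + t • d, g i⟫_ℝ := by fun_prop
          simpa using this.tendsto 0
        exact ((hc.eventually_lt_const hlt).mono fun t ht => ht.le).filter_mono nhdsWithin_le_nhds
    filter_upwards [(Filter.eventually_all_finset I).2 hI] with t ht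
    refine ⟨fun i hi => ?_, ht⟩
    rw [inner_add_left, real_inner_smul_left, hdE i hi, hx.1 i hi]
    simp
  obtain ⟨t, ht, htpos⟩ := (hstep.and self_mem_nhdsWithin).exists
  have hd0 : d = 0 := by
    have h1 := hvi _ ht
    rw [add_sub_cancel_left, real_inner_smul_right] at h1
    have h2 : ⟪v - x, d⟫_ℝ = ⟪d, d⟫_ℝ := by
      have : v - x = d + w := by rw [hd]; abel
      rw [this, inner_add_left, real_inner_comm, real_inner_comm d w, hdw, add_zero]
    have h3 : 0 ≤ ⟪d, d⟫_ℝ := real_inner_self_nonneg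
    rw [h2] at h1
    have htp : (0 : ℝ) < t := htpos
    have h4 : ⟪d, d⟫_ℝ ≤ 0 := by
      by_contra! hcon
      linarith [mul_pos htp hcon]
    exact inner_self_eq_zero.1 (le_antisymm h4 h3)
  obtain ⟨J, lam, h1, h2, h3, h4, h5⟩ := exists_linearIndepOn_conic_combination g hE A hEA l hl
  refine ⟨J, lam, hx, h1, fun i hi => hact i (h2 hi), fun i hi => hmemI i (h2 hi), h4, h3, ?_⟩
  rw [h5, ← hw, ← sub_eq_zero, ← hd, hd0]

end Polyhedron

/-! ### From piecewise to global Lipschitz bounds along a path -/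

section Interpolation

/-- A continuous path which is `C`-Lipschitz on each class of a finite partition of its parameter
interval moves by at most `C`. -/
theorem norm_sub_le_of_finite_partition {F α : Type*} [NormedAddCommGroup F] {φ : ℝ → F}
    {κ : ℝ → α} {C : ℝ} {T : Set α} (hT : T.Finite) (hκ : ∀ t, κ t ∈ T)
    (hφ : ContinuousOn φ (Set.Icc 0 1))
    (h : ∀ s ∈ Set.Icc (0 : ℝ) 1, ∀ t ∈ Set.Icc (0 : ℝ) 1, κ s = κ t →
      ‖φ s - φ t‖ ≤ C * |s - t|) : ‖φ 1 - φ 0‖ ≤ C := by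
  have key : Set.Icc (0 : ℝ) 1 ⊆ {t | ‖φ t - φ 0‖ ≤ C * t} := by
    refine IsClosed.Icc_subset_of_forall_exists_gt ?_ (by simp) ?_
    · have : {t | ‖φ t - φ 0‖ ≤ C * t} ∩ Set.Icc (0 : ℝ) 1 =
          {t ∈ Set.Icc (0 : ℝ) 1 | ‖φ t - φ 0‖ ≤ C * t} := by
        ext t; simp [and_comm]
      rw [this]
      exact isClosed_Icc.isClosed_le ((hφ.sub continuousOn_const).norm) (by fun_prop)
    · rintro x ⟨hx, hx0, hx1⟩ y hy
      have hev : ∀ᶠ t in 𝓝[>] x, t ∈ Set.Ioc x (min y 1) :=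
        Ioc_mem_nhdsGT (lt_min hy hx1)
      -- By pigeonhole some class `a` recurs arbitrarily close to `x` from the right. The point `x`
      -- need not lie in it: the bound between `t` and `s`, both of class `a`, passes to the limit
      -- `s → x` by continuity.
      have hfr : ∃ᶠ t in 𝓝[>] x, ∃ a ∈ T, κ t = a :=
        Filter.Eventually.frequently (Filter.Eventually.of_forall fun t => ⟨_, hκ t, rfl⟩)
      obtain ⟨a, -, ha⟩ := (Filter.frequently_exists_finite hT).1 hfr
      have hfr' := ha.and_eventually hev
      obtain ⟨t, hta, htx⟩ := hfr'.exists
      have htI : t ∈ Set.Icc (0 : ℝ) 1 := ⟨hx0.trans htx.1.le, htx.2.trans (min_le_right _ _)⟩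
      have hlim : Filter.Tendsto φ (𝓝[>] x) (𝓝 (φ x)) := by
        have := (hφ x ⟨hx0, hx1.le⟩).mono_left (nhdsWithin_mono x (s := Set.Ioc x 1)
          fun z hz => ⟨hx0.trans hz.1.le, hz.2⟩)
        rwa [nhdsWithin_Ioc_eq_nhdsGT hx1] at this
      have hcl : ‖φ t - φ x‖ ≤ C * |t - x| := by
        by_contra! hcon
        have h1 : Filter.Tendsto (fun s => C * |t - s|) (𝓝[>] x) (𝓝 (C * |t - x|)) :=
          Filter.Tendsto.mono_left
            ((by fun_prop : Continuous fun s => C * |t - s|).tendsto x) nhdsWithin_le_nhds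
        have h2 := h1.eventually_lt ((tendsto_const_nhds (x := φ t)).sub hlim).norm hcon
        obtain ⟨s, ⟨hsa, hsx⟩, hs⟩ := (hfr'.and_eventually h2).exists
        exact absurd (h t htI s ⟨hx0.trans hsx.1.le, hsx.2.trans (min_le_right _ _)⟩
          (hta.trans hsa.symm)) (not_le.2 hs)
      refine ⟨t, ?_, htx.1, htx.2.trans (min_le_left _ _)⟩
      have hx' : ‖φ x - φ 0‖ ≤ C * x := hx
      rw [abs_of_pos (sub_pos.2 htx.1)] at hcl
      calc ‖φ t - φ 0‖ ≤ ‖φ t - φ x‖ + ‖φ x - φ 0‖ := norm_sub_le_norm_sub_add_norm_sub _ _ _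
        _ ≤ C * t := by linarith
  simpa using key (Set.right_mem_Icc.2 zero_le_one)

end Interpolation

/-! ### Quantitative independence and perturbation of right-hand sides -/

section Estimates

variable {H ι : Type*} [NormedAddCommGroup H] [InnerProductSpace ℝ H]

/-- Quantitative linear independence of `g i`, `i ∈ J`. -/
def CoeffBound (c : ℝ) (g : ι → H) (J : Finset ι) : Prop :=
  ∀ m : ι → ℝ, c * ∑ i ∈ J, |m i| ≤ ‖∑ i ∈ J, m i • g i‖

theorem CoeffBound.linearIndepOn {c : ℝ} (hc : 0 < c) {g : ι → H} {J : Finset ι}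
    (h : CoeffBound c g J) : LinearIndepOn ℝ g (J : Set ι) := by
  rw [linearIndepOn_finset_iff]
  intro m hm i hi
  have h1 := h m
  rw [hm, norm_zero] at h1
  have h2 : |m i| ≤ ∑ i ∈ J, |m i| :=
    Finset.single_le_sum (f := fun i => |m i|) (fun _ _ => abs_nonneg _) hi
  have h3 : |m i| ≤ 0 := by
    by_contra! hcon
    linarith [mul_pos hc (hcon.trans_le h2)]
  exact abs_nonpos_iff.1 h3

theorem abs_sum_mul_le {J : Finset ι} {a b : ι → ℝ} {B : ℝ} (hb : ∀ i ∈ J, |b i| ≤ B) :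
    |∑ i ∈ J, a i * b i| ≤ (∑ i ∈ J, |a i|) * B := by
  refine (Finset.abs_sum_le_sum_abs _ _).trans ?_
  rw [Finset.sum_mul]
  refine Finset.sum_le_sum fun i hi => ?_
  rw [abs_mul]
  exact mul_le_mul_of_nonneg_left (hb i hi) (abs_nonneg _)

theorem norm_sum_smul_le {J : Finset ι} {a : ι → ℝ} {b : ι → H} {B : ℝ}
    (hb : ∀ i ∈ J, ‖b i‖ ≤ B) : ‖∑ i ∈ J, a i • b i‖ ≤ (∑ i ∈ J, |a i|) * B := by
  refine (norm_sum_le _ _).trans ?_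
  rw [Finset.sum_mul]
  refine Finset.sum_le_sum fun i hi => ?_
  rw [norm_smul, Real.norm_eq_abs]
  exact mul_le_mul_of_nonneg_left (hb i hi) (abs_nonneg _)

/-- The Gram operator of an independent family is injective on a finite-dimensional space, hence
surjective. The point `w` is the projection of `v` onto the affine subspace cut out by the
equations. -/
theorem exists_gram_solution {g : ι → H} {J : Finset ι} (hJ : LinearIndepOn ℝ g (J : Set ι))
    (f : ι → ℝ) (v : H) :
    ∃ (m : ι → ℝ) (w : H), v - w = ∑ i ∈ J, m i • g i ∧ ∀ i ∈ J, ⟪w, g i⟫_ℝ = f i := by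
  classical
  let S : (J → ℝ) →ₗ[ℝ] H := Fintype.linearCombination ℝ (fun i : J => g i)
  have hS : ∀ m, S m = ∑ i, m i • g i := fun m => Fintype.linearCombination_apply ℝ _ m
  have hinj : Function.Injective S := hJ.fintypeLinearCombination_injective
  let T : (J → ℝ) →ₗ[ℝ] (J → ℝ) := LinearMap.pi fun i => (innerₛₗ ℝ (g i)).comp S
  have hT : ∀ m i, T m i = ⟪g i, S m⟫_ℝ := fun m i => rfl
  have hTinj : Function.Injective T := by
    rw [injective_iff_map_eq_zero]
    intro m hm
    have h0 : ⟪S m, S m⟫_ℝ = 0 := by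
      conv_lhs => enter [2]; rw [hS]
      rw [sum_inner]
      refine Finset.sum_eq_zero fun i _ => ?_
      rw [real_inner_smul_left, ← hT, hm]
      simp
    exact hinj ((inner_self_eq_zero.1 h0).trans S.map_zero.symm)
  obtain ⟨m, hm⟩ := LinearMap.injective_iff_surjective.1 hTinj fun i => ⟪v, g i⟫_ℝ - f i
  refine ⟨fun i => if h : i ∈ J then m ⟨i, h⟩ else 0, v - S m, ?_, fun i hi => ?_⟩
  · rw [sub_sub_cancel, hS, ← Finset.sum_coe_sort J]
    simp
  · have := congrFun hm ⟨i, hi⟩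
    rw [hT] at this
    rw [inner_sub_left, real_inner_comm (g i) (S m), this]
    ring

/-- Stability of the solution of the equality constrained problem with a fixed support. -/
theorem norm_sub_le_of_common_support {g₁ g₂ : ι → H} {f₁ f₂ : ι → ℝ} {J : Finset ι}
    {c M R δ : ℝ} {v x w : H} {l m : ι → ℝ} (hc : 0 < c) (hR₀ : 0 ≤ R) (hM₀ : 0 ≤ M)
    (hb : CoeffBound c g₂ J)
    (hg : ∀ i ∈ J, ‖g₁ i - g₂ i‖ ≤ δ) (hf : ∀ i ∈ J, |f₁ i - f₂ i| ≤ δ) (hδ : 0 ≤ δ)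
    (hM : ∑ i ∈ J, |l i| ≤ M) (hR : ‖x‖ ≤ R)
    (hx : v - x = ∑ i ∈ J, l i • g₁ i) (hw : v - w = ∑ i ∈ J, m i • g₂ i)
    (hxJ : ∀ i ∈ J, ⟪x, g₁ i⟫_ℝ = f₁ i) (hwJ : ∀ i ∈ J, ⟪w, g₂ i⟫_ℝ = f₂ i) :
    ‖x - w‖ ≤ 2 * ((R + 1) / c + M) * δ ∧
      ∑ i ∈ J, |m i - l i| ≤ (2 * ((R + 1) / c + M) + M) * δ / c := by
  set d := x - w with hd
  set S := ∑ i ∈ J, |m i - l i| with hS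
  have hsum : ∑ i ∈ J, (m i - l i) • g₂ i = d + ∑ i ∈ J, l i • (g₁ i - g₂ i) := by
    simp only [sub_smul, smul_sub, Finset.sum_sub_distrib, ← hw, ← hx, hd]
    abel
  have hdJ : ∀ i ∈ J, ⟪d, g₂ i⟫_ℝ = f₁ i - f₂ i - ⟪x, g₁ i - g₂ i⟫_ℝ := by
    intro i hi
    rw [hd, inner_sub_left, inner_sub_right, hxJ i hi, hwJ i hi]
    ring
  have hdR : ∀ i ∈ J, |⟪d, g₂ i⟫_ℝ| ≤ (R + 1) * δ := by
    intro i hi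
    rw [hdJ i hi]
    have h1 : |⟪x, g₁ i - g₂ i⟫_ℝ| ≤ R * δ :=
      (abs_real_inner_le_norm _ _).trans (mul_le_mul hR (hg i hi) (norm_nonneg _) hR₀)
    have := (abs_sub _ _).trans (add_le_add (hf i hi) h1)
    linarith
  have hle : ‖∑ i ∈ J, l i • (g₁ i - g₂ i)‖ ≤ M * δ :=
    (norm_sum_smul_le hg).trans (mul_le_mul_of_nonneg_right hM hδ)
  have hcS : c * S ≤ ‖d‖ + M * δ := by
    have := hb fun i => m i - l i
    rw [hsum] at this
    exact this.trans ((norm_add_le _ _).trans (by linarith))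
  -- Pair `d` with its representation `hsum`: the components `⟪d, g₂ i⟫` are of order `δ`. Since `c
  -- * S` is controlled by `‖d‖ + M * δ`, this becomes a quadratic inequality in `‖d‖`.
  have hsq : ‖d‖ ^ 2 ≤ S * ((R + 1) * δ) + M * δ * ‖d‖ := by
    have h1 : ‖d‖ ^ 2 = ∑ i ∈ J, (m i - l i) * ⟪d, g₂ i⟫_ℝ
        - ⟪d, ∑ i ∈ J, l i • (g₁ i - g₂ i)⟫_ℝ := by
      have : ∑ i ∈ J, (m i - l i) * ⟪d, g₂ i⟫_ℝ = ⟪d, ∑ i ∈ J, (m i - l i) • g₂ i⟫_ℝ := by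
        rw [inner_sum]
        exact Finset.sum_congr rfl fun i _ => (real_inner_smul_right _ _ _).symm
      rw [this, hsum, inner_add_right, real_inner_self_eq_norm_sq]
      ring
    have h2 := le_of_abs_le (abs_sum_mul_le (a := fun i => m i - l i) hdR)
    have h3 := neg_le_of_abs_le ((abs_real_inner_le_norm d (∑ i ∈ J, l i • (g₁ i - g₂ i))).trans
      (mul_le_mul_of_nonneg_left hle (norm_nonneg d)))
    rw [h1]
    linarith
  set a := (R + 1) / c with ha
  have ha0 : 0 ≤ a := by positivity
  have hac : R + 1 = a * c := by rw [ha]; field_simp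
  have hsq' : ‖d‖ ^ 2 ≤ a * δ * (‖d‖ + M * δ) + M * δ * ‖d‖ := by
    refine hsq.trans ?_
    have : S * ((R + 1) * δ) = a * δ * (c * S) := by rw [hac]; ring
    rw [this]
    gcongr
  have hfirst : ‖d‖ ≤ 2 * (a + M) * δ := by
    by_contra! hcon
    have h1 : 0 ≤ (a + M) * δ := by positivity
    have h2 : a * δ * (M * δ) ≤ ((a + M) * δ) * ((a + M) * δ) := by
      gcongr <;> linarith
    nlinarith
  refine ⟨hfirst, ?_⟩
  rw [le_div_iff₀ hc]
  linarith

/-- Each multiplier is paired with the change of its own right-hand side, so solutions of problems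
differing only in `f` can be compared. -/
theorem IsKKT.inner_le {g : ι → H} {f f' : ι → ℝ} {E I J : Finset ι} {v x y : H} {lam : ι → ℝ}
    (h : IsKKT g f E I J v x lam) (hy : y ∈ polyhedron g f' E I) :
    ⟪v - x, y - x⟫_ℝ ≤ ∑ i ∈ J, lam i * (f' i - f i) := by
  rw [h.sum_eq, sum_inner]
  refine Finset.sum_le_sum fun i hi => ?_
  rw [real_inner_smul_left, inner_sub_right, real_inner_comm, real_inner_comm x, h.active i hi]
  by_cases hE : i ∈ E
  · rw [hy.1 i hE]
  · have := hy.2 i (h.mem_of_notMem i hi hE)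
    exact mul_le_mul_of_nonneg_left (by linarith) (h.nonneg i hi hE)

theorem IsKKT.sum_abs_le {g : ι → H} {f : ι → ℝ} {E I J : Finset ι} {v x : H} {lam : ι → ℝ}
    {c : ℝ} (h : IsKKT g f E I J v x lam) (hc : 0 < c) (hb : CoeffBound c g J) :
    ∑ i ∈ J, |lam i| ≤ ‖v - x‖ / c := by
  rw [le_div_iff₀ hc, mul_comm, h.sum_eq]
  exact hb lam

/-- Relaxing the right-hand sides of a polyhedron moves the projection in a Lipschitz way, with a
constant depending only on the quantitative independence of the subfamilies of its normals. -/
theorem norm_sub_le_of_relaxation [CompleteSpace H] [DecidableEq ι] {g : ι → H} {f r : ι → ℝ}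
    {E I : Finset ι} {c ρ : ℝ} {v x y : H} (hc : 0 < c) (hE : LinearIndepOn ℝ g (E : Set ι))
    (hb : ∀ J, E ⊆ J → J ⊆ E ∪ I → LinearIndepOn ℝ g (J : Set ι) → CoeffBound c g J)
    (hr₀ : ∀ i ∈ I, 0 ≤ r i) (hrE : ∀ i ∈ E, r i = 0) (hr : ∀ i ∈ I, r i ≤ ρ) (hρ : 0 ≤ ρ)
    (hx : IsNearest (polyhedron g f E I) v x)
    (hy : IsNearest (polyhedron g (f + r) E I) v y) : ‖y - x‖ ≤ ρ / c := by
  have hne : ∀ t ∈ Set.Icc (0 : ℝ) 1, x ∈ polyhedron g (f + t • r) E I := by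
    intro t ht
    refine ⟨fun i hi => ?_, fun i hi => ?_⟩
    · simpa [hrE i hi] using hx.1.1 i hi
    · have := hx.1.2 i hi
      have := mul_nonneg ht.1 (hr₀ i hi)
      simp only [Pi.add_apply, Pi.smul_apply, smul_eq_mul]
      linarith
  -- The inclusion `J ⊆ E ∪ I` is kept for every real `t`, with default `∅` off the interval, so
  -- that the supports form a finite partition.
  have hex : ∀ t : ℝ, ∃ (z : H) (J : Finset ι) (l : ι → ℝ), J ⊆ E ∪ I ∧ (t ∈ Set.Icc (0 : ℝ) 1 →
      IsKKT g (f + t • r) E I J v z l) := by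
    intro t
    by_cases ht : t ∈ Set.Icc (0 : ℝ) 1
    · obtain ⟨J, l, h⟩ := (isNearest_proj (convex_polyhedron _ _ _ _) (isClosed_polyhedron _ _ _ _)
        ⟨x, hne t ht⟩ v).exists_isKKT hE
      refine ⟨_, J, l, fun i hi => ?_, fun _ => h⟩
      by_cases hiE : i ∈ E
      exacts [Finset.mem_union_left _ hiE, Finset.mem_union_right _ (h.mem_of_notMem i hi hiE)]
    · exact ⟨0, ∅, 0, Finset.empty_subset _, fun h => absurd h ht⟩
  choose z J l hJ hz using hex
  have hrJ : ∀ t ∈ Set.Icc (0 : ℝ) 1, ∀ s t', ∀ i ∈ J t, |(t' - s) * r i| ≤ |t' - s| * ρ := by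
    intro t ht s t' i hi
    rw [abs_mul]
    gcongr
    by_cases hiE : i ∈ E
    · rwa [hrE i hiE, abs_zero]
    · have hiI := (hz t ht).mem_of_notMem i hi hiE
      rw [abs_of_nonneg (hr₀ i hiI)]
      exact hr i hiI
  have hpair : ∀ s ∈ Set.Icc (0 : ℝ) 1, ∀ t ∈ Set.Icc (0 : ℝ) 1, ‖z s - z t‖ ^ 2 ≤
      ∑ i ∈ J s, l s i * ((t - s) * r i) - ∑ i ∈ J t, l t i * ((t - s) * r i) := by
    intro s hs t ht
    have h1 := (hz s hs).inner_le (hz t ht).mem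
    have h2 := (hz t ht).inner_le (hz s hs).mem
    have e1 : ∀ i, (f + t • r) i - (f + s • r) i = (t - s) * r i := by
      intro i; simp only [Pi.add_apply, Pi.smul_apply, smul_eq_mul]; ring
    have e2 : ∀ i, (f + s • r) i - (f + t • r) i = -((t - s) * r i) := by
      intro i; simp only [Pi.add_apply, Pi.smul_apply, smul_eq_mul]; ring
    simp only [e1] at h1
    simp only [e2, mul_neg, Finset.sum_neg_distrib] at h2
    have e : ‖z s - z t‖ ^ 2 = ⟪v - z s, z t - z s⟫_ℝ + ⟪v - z t, z s - z t⟫_ℝ := by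
      rw [← real_inner_self_eq_norm_sq]
      simp only [inner_sub_left, inner_sub_right]
      ring
    rw [e]
    linarith
  have hbJ : ∀ t ∈ Set.Icc (0 : ℝ) 1, CoeffBound c g (J t) := fun t ht =>
    hb _ (hz t ht).subset (hJ t) (hz t ht).linInd
  have hM : ∀ t ∈ Set.Icc (0 : ℝ) 1, ∑ i ∈ J t, |l t i| ≤ ‖v - x‖ / c := fun t ht =>
    ((hz t ht).sum_abs_le hc (hbJ t ht)).trans (div_le_div_of_nonneg_right
      ((hz t ht).isNearest.norm_sub_le_of_mem (hne t ht)) hc.le)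
  -- When supports differ, `hpair` and the bound on multipliers give only Hölder exponent `1/2`,
  -- which suffices for continuity.
  have hcont : ContinuousOn z (Set.Icc 0 1) := by
    intro s hs
    have hbound : ∀ t ∈ Set.Icc (0 : ℝ) 1,
        ‖z t - z s‖ ^ 2 ≤ 2 * (‖v - x‖ / c) * (|t - s| * ρ) := by
      intro t ht
      rw [norm_sub_rev]
      have h1 := le_of_abs_le (abs_sum_mul_le (a := l s) (hrJ s hs s t))
      have h2 := neg_le_of_abs_le (abs_sum_mul_le (a := l t) (hrJ t ht s t))
      have h0 : 0 ≤ |t - s| * ρ := by positivity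
      have h3 := mul_le_mul_of_nonneg_right (hM s hs) h0
      have h4 := mul_le_mul_of_nonneg_right (hM t ht) h0
      linarith [hpair s hs t ht]
    have hlim : Filter.Tendsto (fun t => 2 * (‖v - x‖ / c) * (|t - s| * ρ))
        (𝓝[Set.Icc 0 1] s) (𝓝 0) := by
      have : Continuous fun t => 2 * (‖v - x‖ / c) * (|t - s| * ρ) := by fun_prop
      have := this.tendsto s
      simp only [sub_self, abs_zero, zero_mul, mul_zero] at this
      exact this.mono_left nhdsWithin_le_nhds
    have hsq : Filter.Tendsto (fun t => ‖z t - z s‖ ^ 2) (𝓝[Set.Icc 0 1] s) (𝓝 0) :=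
      squeeze_zero' (Filter.Eventually.of_forall fun t => sq_nonneg _)
        (Filter.eventually_of_mem self_mem_nhdsWithin hbound) hlim
    rw [ContinuousWithinAt, tendsto_iff_norm_sub_tendsto_zero]
    have := (Real.continuous_sqrt.tendsto 0).comp hsq
    simpa [Function.comp_def, Real.sqrt_sq (norm_nonneg _)] using this
  -- On a common support the multiplier difference is itself at most `‖z s - z t‖ / c`, so one
  -- factor of the squared norm cancels.
  have hlip : ∀ s ∈ Set.Icc (0 : ℝ) 1, ∀ t ∈ Set.Icc (0 : ℝ) 1, J s = J t →
      ‖z s - z t‖ ≤ ρ / c * |s - t| := by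
    intro s hs t ht hst
    have h1 := hpair s hs t ht
    rw [← hst, ← Finset.sum_sub_distrib] at h1
    simp only [← sub_mul] at h1
    have h2 := le_of_abs_le (abs_sum_mul_le (a := fun i => l s i - l t i) (hrJ s hs s t))
    have h3 := hbJ s hs fun i => l s i - l t i
    have e : ∑ i ∈ J s, (l s i - l t i) • g i = z t - z s := by
      simp only [sub_smul, Finset.sum_sub_distrib]
      rw [← (hz s hs).sum_eq, hst, ← (hz t ht).sum_eq]
      abel
    rw [e, norm_sub_rev] at h3
    set N := ‖z s - z t‖
    set S := ∑ i ∈ J s, |l s i - l t i|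
    have hN : 0 ≤ N := norm_nonneg _
    have h4 : c * N ^ 2 ≤ N * (|t - s| * ρ) := by
      calc c * N ^ 2 ≤ c * (S * (|t - s| * ρ)) := by gcongr; linarith
        _ = c * S * (|t - s| * ρ) := by ring
        _ ≤ _ := by gcongr
    rw [div_mul_eq_mul_div, le_div_iff₀ hc, abs_sub_comm]
    rcases hN.eq_or_lt with h | h
    · rw [← h, zero_mul]; positivity
    · refine le_of_mul_le_mul_left ?_ h
      linarith
  have h0 : z 0 = x := by
    have := (hz 0 (by simp)).isNearest
    simp only [zero_smul, add_zero] at this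
    exact this.unique hx
  have h1 : z 1 = y := by
    have := (hz 1 (by simp)).isNearest
    simp only [one_smul] at this
    exact this.unique hy
  rw [← h0, ← h1]
  exact norm_sub_le_of_finite_partition (κ := J) (E ∪ I).powerset.finite_toSet
    (fun t => Finset.mem_coe.2 (Finset.mem_powerset.2 (hJ t))) hcont hlip

end Estimates

/-! ### Lipschitz dependence on all the data of a polyhedron -/

section Perturbation

variable {H ι : Type*} [NormedAddCommGroup H] [InnerProductSpace ℝ H]

/-- Bound for the displacement, per unit of perturbation, of the solution of an equality constrained
projection problem. -/
noncomputable def primalConst (c R : ℝ) : ℝ := 2 * ((R + 1) / c + R / c)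

/-- Bound for the displacement, per unit of perturbation, of the multiplier of an equality
constrained projection problem. -/
noncomputable def dualConst (c R : ℝ) : ℝ := (primalConst c R + R / c) / c

/-- Lipschitz constant of the projection with respect to the data of the polyhedron. -/
noncomputable def dataConst (c R : ℝ) : ℝ :=
  primalConst c R + (primalConst c R * R + R + 1) / c + dualConst c R * R

theorem dataConst_nonneg {c R : ℝ} (hc : 0 < c) (hR : 0 ≤ R) : 0 ≤ dataConst c R := by
  unfold dataConst dualConst primalConst
  positivity

/-- Lipschitz dependence of the projection onto a polyhedron on the data of the polyhedron. -/
theorem norm_sub_le_of_data_perturbation [CompleteSpace H] [DecidableEq ι] {g₁ g₂ : ι → H}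
    {f₁ f₂ : ι → ℝ} {E I : Finset ι} {c R δ : ℝ} {v x₁ x₂ : H} (hc : 0 < c) (hR : 0 ≤ R)
    (hδ : 0 ≤ δ) (hE₁ : LinearIndepOn ℝ g₁ (E : Set ι)) (hE₂ : LinearIndepOn ℝ g₂ (E : Set ι))
    (hb₁ : ∀ J, E ⊆ J → J ⊆ E ∪ I → LinearIndepOn ℝ g₁ (J : Set ι) →
      CoeffBound c g₁ J ∧ CoeffBound c g₂ J)
    (hb₂ : ∀ J, E ⊆ J → J ⊆ E ∪ I → LinearIndepOn ℝ g₂ (J : Set ι) → CoeffBound c g₂ J)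
    (hg : ∀ i ∈ E ∪ I, ‖g₁ i - g₂ i‖ ≤ δ) (hf : ∀ i ∈ E ∪ I, |f₁ i - f₂ i| ≤ δ)
    (hgR : ∀ i ∈ E ∪ I, ‖g₂ i‖ ≤ R) (hxR : ‖x₁‖ ≤ R) (hvR : ‖v - x₁‖ ≤ R)
    (h₁ : IsNearest (polyhedron g₁ f₁ E I) v x₁) (h₂ : IsNearest (polyhedron g₂ f₂ E I) v x₂) :
    ‖x₁ - x₂‖ ≤ dataConst c R * δ := by
  obtain ⟨J, l, hJ⟩ := h₁.exists_isKKT hE₁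
  have hJs : J ⊆ E ∪ I := fun i hi => by
    by_cases hiE : i ∈ E
    exacts [Finset.mem_union_left _ hiE, Finset.mem_union_right _ (hJ.mem_of_notMem i hi hiE)]
  obtain ⟨hcb₁, hcb₂⟩ := hb₁ J hJ.subset hJs hJ.linInd
  have hl : ∑ i ∈ J, |l i| ≤ R / c :=
    (hJ.sum_abs_le hc hcb₁).trans (div_le_div_of_nonneg_right hvR hc.le)
  obtain ⟨m, w, hw, hwJ⟩ := exists_gram_solution (hcb₂.linearIndepOn hc) f₂ v
  obtain ⟨hxw, hml⟩ := norm_sub_le_of_common_support hc hR (by positivity : 0 ≤ R / c) hcb₂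
    (fun i hi => hg i (hJs hi)) (fun i hi => hf i (hJs hi)) hδ hl hxR hJ.sum_eq hw hJ.active hwJ
  change ‖x₁ - w‖ ≤ primalConst c R * δ at hxw
  have hml' : ∑ i ∈ J, |m i - l i| ≤ dualConst c R * δ := by
    refine hml.trans (le_of_eq ?_)
    simp only [dualConst, primalConst]
    ring
  have hp : 0 ≤ primalConst c R := by unfold primalConst; positivity
  -- `w` is the projection of a shifted point onto a relaxed polyhedron
  let r : ι → ℝ := fun i => if i ∈ E then 0 else max (⟪w, g₂ i⟫_ℝ - f₂ i) 0
  let m' : ι → ℝ := fun i => if i ∈ E then m i else max (m i) 0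
  let v' : H := w + ∑ i ∈ J, m' i • g₂ i
  have hrE : ∀ i ∈ E, r i = 0 := fun i hi => by simp [r, hi]
  have hr₀ : ∀ i, 0 ≤ r i := fun i => by
    simp only [r]
    split_ifs
    exacts [le_rfl, le_max_right _ _]
  have hrJ : ∀ i ∈ J, r i = 0 := fun i hi => by simp [r, hwJ i hi]
  have hr : ∀ i ∈ I, r i ≤ (primalConst c R * R + R + 1) * δ := by
    intro i hi
    have h0 : 0 ≤ (primalConst c R * R + R + 1) * δ := by positivity
    have hi' : i ∈ E ∪ I := Finset.mem_union_right _ hi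
    simp only [r]
    split_ifs
    · exact h0
    refine max_le ?_ h0
    -- The violation at `w` is compared with the constraint at `x₁`, which holds for the first data;
    -- every other term is of order `δ`.
    have e : ⟪w, g₂ i⟫_ℝ - f₂ i = ⟪w - x₁, g₂ i⟫_ℝ + ⟪x₁, g₂ i - g₁ i⟫_ℝ
        + (⟪x₁, g₁ i⟫_ℝ - f₁ i) + (f₁ i - f₂ i) := by
      simp only [inner_sub_left, inner_sub_right]; ring
    have a1 : ⟪w - x₁, g₂ i⟫_ℝ ≤ primalConst c R * δ * R := by
      refine (real_inner_le_norm _ _).trans ?_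
      rw [norm_sub_rev]
      exact mul_le_mul hxw (hgR i hi') (norm_nonneg _) (by positivity)
    have a2 : ⟪x₁, g₂ i - g₁ i⟫_ℝ ≤ R * δ := by
      refine (real_inner_le_norm _ _).trans ?_
      rw [norm_sub_rev]
      exact mul_le_mul hxR (hg i hi') (norm_nonneg _) hR
    have a3 := hJ.mem.2 i hi
    have a4 := le_of_abs_le (hf i hi')
    rw [e]
    linarith
  have hwn : IsNearest (polyhedron g₂ (f₂ + r) E I) v' w := by
    refine isNearest_of_multiplier (J := J) (lam := m') ⟨fun i hi => ?_, fun i hi => ?_⟩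
      (fun i hi => ?_) (fun i hi hiE => ⟨hJ.mem_of_notMem i hi hiE, ?_⟩) (by simp [v'])
    · simp [hrE i hi, hwJ i (hJ.subset hi)]
    · rw [Pi.add_apply]
      by_cases hiE : i ∈ E
      · rw [hrE i hiE, hwJ i (hJ.subset hiE), add_zero]
      · have := le_max_left (⟪w, g₂ i⟫_ℝ - f₂ i) 0
        simp only [r, hiE, if_false]
        linarith
    · simp [hrJ i hi, hwJ i hi]
    · simp [m', hiE]
  have hv' : ‖v' - v‖ ≤ dualConst c R * R * δ := by
    have e : v' - v = ∑ i ∈ J, (m' i - m i) • g₂ i := by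
      simp only [sub_smul, Finset.sum_sub_distrib, ← hw, v']
      abel
    rw [e]
    refine (norm_sum_smul_le fun i hi => hgR i (hJs hi)).trans ?_
    -- Truncation at zero moves `m i` no farther than its distance to the nonnegative number `l i`.
    have : ∑ i ∈ J, |m' i - m i| ≤ ∑ i ∈ J, |m i - l i| := by
      refine Finset.sum_le_sum fun i hi => ?_
      by_cases hiE : i ∈ E
      · simp [m', hiE]
      · have := hJ.nonneg i hi hiE
        simp only [m', hiE, if_false]
        rcases le_total 0 (m i) with h | h
        · simp [max_eq_left h]
        · rw [max_eq_right h, zero_sub, abs_neg, abs_of_nonpos h, abs_of_nonpos (by linarith)]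
          linarith
    calc _ ≤ dualConst c R * δ * R := mul_le_mul_of_nonneg_right (this.trans hml') hR
      _ = _ := by ring
  -- The projection of `v'` onto the unrelaxed polyhedron is the intermediate point: the relaxation
  -- separates it from `w`, the shift from `x₂`.
  have hn := isNearest_proj (convex_polyhedron g₂ f₂ E I) (isClosed_polyhedron g₂ f₂ E I)
    ⟨x₂, h₂.1⟩ v'
  have b1 := norm_sub_le_of_relaxation hc hE₂ hb₂ (fun i _ => hr₀ i) hrE hr (by positivity) hn hwn
  have b2 := (hn.norm_sub_le h₂).trans hv'
  have t1 := norm_sub_le_norm_sub_add_norm_sub x₁ w x₂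
  have t2 := norm_sub_le_norm_sub_add_norm_sub w (proj (polyhedron g₂ f₂ E I) v') x₂
  have e : dataConst c R * δ = primalConst c R * δ +
      ((primalConst c R * R + R + 1) * δ / c + dualConst c R * R * δ) := by
    unfold dataConst; ring
  linarith

end Perturbation

/-! ### Uniform bounds near the reference parameter and continuity of the projection -/

section Local

variable {X H ι : Type*} [NormedAddCommGroup H] [InnerProductSpace ℝ H]

theorem CoeffBound.mono {c c' : ℝ} {g : ι → H} {J : Finset ι} (h : CoeffBound c g J)
    (hc : c' ≤ c) : CoeffBound c' g J := fun m =>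
  (mul_le_mul_of_nonneg_right hc (Finset.sum_nonneg fun _ _ => abs_nonneg _)).trans (h m)

/-- An injective linear map on a finite-dimensional space is antilipschitz. Passing from the sup
norm to the sum of coefficients costs `J.card`; the `+ 1` keeps the denominator positive. -/
theorem exists_coeffBound {g : ι → H} {J : Finset ι} (hJ : LinearIndepOn ℝ g (J : Set ι)) :
    ∃ c > 0, CoeffBound c g J := by
  classical
  let S : (J → ℝ) →ₗ[ℝ] H := Fintype.linearCombination ℝ (fun i : J => g i)
  obtain ⟨K, hK, hS⟩ := S.exists_antilipschitzWith
    (LinearMap.ker_eq_bot.2 hJ.fintypeLinearCombination_injective)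
  have hpos : (0 : ℝ) < J.card * K + 1 := by positivity
  refine ⟨1 / (J.card * K + 1), by positivity, fun m => ?_⟩
  have h1 : ∀ a : J → ℝ, ‖a‖ ≤ K * ‖S a‖ := fun a => by
    simpa using hS.le_mul_dist a 0
  have h2 : S (fun i => m i) = ∑ i ∈ J, m i • g i := by
    rw [Fintype.linearCombination_apply]
    exact Finset.sum_coe_sort J fun i => m i • g i
  have h3 : ∑ i ∈ J, |m i| ≤ J.card * (K * ‖∑ i ∈ J, m i • g i‖) := by
    rw [← nsmul_eq_mul]
    refine Finset.sum_le_card_nsmul _ _ _ fun i hi => ?_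
    rw [← h2]
    exact (norm_le_pi_norm (fun i : J => m i) ⟨i, hi⟩).trans (h1 _)
  rw [one_div, inv_mul_le_iff₀ hpos]
  linarith [norm_nonneg (∑ i ∈ J, m i • g i)]

/-- Half of the constant at `p` absorbs the displacement of the vectors. -/
theorem exists_eventually_coeffBound [TopologicalSpace X] {g : ι → X → H} {p : X} {J : Finset ι}
    (hg : ∀ i ∈ J, ContinuousAt (g i) p) (hJ : LinearIndepOn ℝ (fun i => g i p) (J : Set ι)) :
    ∃ c > 0, ∀ᶠ q in 𝓝 p, CoeffBound c (fun i => g i q) J := by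
  obtain ⟨c, hc, h⟩ := exists_coeffBound hJ
  refine ⟨c / 2, half_pos hc, ?_⟩
  have hev : ∀ᶠ q in 𝓝 p, ∀ i ∈ J, ‖g i p - g i q‖ ≤ c / 2 := by
    refine (Filter.eventually_all_finset J).2 fun i hi => ?_
    filter_upwards [Metric.tendsto_nhds.1 (hg i hi) (c / 2) (half_pos hc)] with q hq
    rw [dist_comm, dist_eq_norm] at hq
    exact hq.le
  filter_upwards [hev] with q hq m
  have h1 := norm_sum_smul_le (a := m) hq
  have h2 := h m
  have h3 : ∑ i ∈ J, m i • g i p = ∑ i ∈ J, m i • g i q + ∑ i ∈ J, m i • (g i p - g i q) := by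
    rw [← Finset.sum_add_distrib]
    exact Finset.sum_congr rfl fun i _ => by rw [smul_sub]; abel
  rw [h3] at h2
  have h4 := norm_add_le (∑ i ∈ J, m i • g i q) (∑ i ∈ J, m i • (g i p - g i q))
  linarith

theorem exists_eventually_forall_coeffBound [TopologicalSpace X] {g : ι → X → H} {p : X}
    (F : Finset (Finset ι)) (hg : ∀ J ∈ F, ∀ i ∈ J, ContinuousAt (g i) p)
    (hF : ∀ J ∈ F, LinearIndepOn ℝ (fun i => g i p) (J : Set ι)) :
    ∃ c > 0, ∀ᶠ q in 𝓝 p, ∀ J ∈ F, CoeffBound c (fun i => g i q) J := by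
  classical
  induction F using Finset.induction_on with
  | empty => exact ⟨1, one_pos, by simp⟩
  | insert J F _ ih =>
    obtain ⟨c, hc, h⟩ := ih (fun J' hJ' => hg J' (Finset.mem_insert_of_mem hJ'))
      fun J' hJ' => hF J' (Finset.mem_insert_of_mem hJ')
    obtain ⟨c', hc', h'⟩ := exists_eventually_coeffBound (hg J (Finset.mem_insert_self _ _))
      (hF J (Finset.mem_insert_self _ _))
    refine ⟨min c c', lt_min hc hc', ?_⟩
    filter_upwards [h, h'] with q hq hq' J' hJ'
    rcases Finset.mem_insert.1 hJ' with rfl | hJ'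
    exacts [hq'.mono (min_le_right _ _), (hq J' hJ').mono (min_le_left _ _)]

theorem linearIndepOn_of_finrank_eq {g₁ g₂ : ι → H} {J : Finset ι}
    (h : LinearIndepOn ℝ g₁ (J : Set ι))
    (hr : Module.finrank ℝ (Submodule.span ℝ (g₁ '' (J : Set ι))) =
      Module.finrank ℝ (Submodule.span ℝ (g₂ '' (J : Set ι)))) :
    LinearIndepOn ℝ g₂ (J : Set ι) := by
  have e : ∀ g : ι → H, LinearIndepOn ℝ g (J : Set ι) ↔
      Fintype.card (J : Set ι) = Module.finrank ℝ (Submodule.span ℝ (g '' (J : Set ι))) := by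
    intro g
    rw [LinearIndepOn, linearIndependent_iff_card_eq_finrank_span, Set.finrank,
      Set.image_eq_range]
  rw [e] at h ⊢
  rw [h, hr]

theorem exists_eventually_forall_dist_le {P F : Type*} [PseudoMetricSpace P]
    [PseudoMetricSpace F] {S : Finset ι} {φ : ι → P → F} (hφ : ∀ i ∈ S, LocallyLipschitz (φ i))
    (p : P) : ∃ C, 0 ≤ C ∧ ∃ U ∈ 𝓝 p, ∀ i ∈ S, ∀ q₁ ∈ U, ∀ q₂ ∈ U,
      dist (φ i q₁) (φ i q₂) ≤ C * dist q₁ q₂ := by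
  classical
  induction S using Finset.induction_on with
  | empty => exact ⟨0, le_rfl, Set.univ, Filter.univ_mem, by simp⟩
  | insert j S _ ih =>
    obtain ⟨C, hC, U, hU, h⟩ := ih fun i hi => hφ i (Finset.mem_insert_of_mem hi)
    obtain ⟨C', V, hV, h'⟩ := hφ j (Finset.mem_insert_self _ _) p
    refine ⟨max C C', hC.trans (le_max_left _ _), U ∩ V, Filter.inter_mem hU hV, ?_⟩
    intro i hi q₁ hq₁ q₂ hq₂
    rcases Finset.mem_insert.1 hi with rfl | hi
    · exact (h'.dist_le_mul q₁ hq₁.2 q₂ hq₂.2).trans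
        (mul_le_mul_of_nonneg_right (le_max_right _ _) dist_nonneg)
    · exact (h i hi q₁ hq₁.1 q₂ hq₂.1).trans
        (mul_le_mul_of_nonneg_right (le_max_left _ _) dist_nonneg)

/-- Under the Mangasarian-Fromovitz condition the feasible set has points close to the reference
point for all nearby parameters. -/
theorem MFCQ.eventually_exists_feasible [TopologicalSpace X] {g : ι → X → H} {f : ι → X → ℝ}
    {E I : Finset ι} {p : X} {x : H} (h : MFCQ g f E I p x)
    (hgE : ∀ i ∈ E, ContinuousAt (g i) p) (hgI : ∀ i ∈ I, ContinuousAt (g i) p)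
    (hfE : ∀ i ∈ E, ContinuousAt (f i) p) (hfI : ∀ i ∈ I, ContinuousAt (f i) p)
    {ε : ℝ} (hε : 0 < ε) :
    ∀ᶠ q in 𝓝 p, ∃ y ∈ feasibleSet g f E I q, ‖y - x‖ < ε := by
  obtain ⟨hx, hE, d, hdE, hdI⟩ := h
  have hcont : ∀ a : H, Filter.Tendsto (fun t : ℝ => ⟪x + t • d, a⟫_ℝ) (𝓝 0) (𝓝 ⟪x, a⟫_ℝ) := by
    intro a
    have : Continuous fun t : ℝ => ⟪x + t • d, a⟫_ℝ := by fun_prop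
    simpa using this.tendsto 0
  have hstrict : ∀ᶠ t : ℝ in 𝓝[>] 0, ∀ i ∈ I, ⟪x + t • d, g i p⟫_ℝ < f i p := by
    refine (Filter.eventually_all_finset I).2 fun i hi => ?_
    rcases (hx.2 i hi).lt_or_eq with hlt | heq
    · exact ((hcont _).eventually_lt_const hlt).filter_mono nhdsWithin_le_nhds
    · filter_upwards [self_mem_nhdsWithin] with t ht
      have := hdI i hi ⟨Or.inr hi, heq⟩
      rw [inner_add_left, real_inner_smul_left, heq, real_inner_comm]
      have := mul_neg_of_pos_of_neg (Set.mem_Ioi.1 ht) this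
      linarith
  have hsmall : ∀ᶠ t : ℝ in 𝓝[>] 0, ‖(x + t • d) - x‖ < ε := by
    have : Continuous fun t : ℝ => ‖(x + t • d) - x‖ := by fun_prop
    have := this.tendsto 0
    simp only [zero_smul, add_zero, sub_self, norm_zero] at this
    exact (this.eventually_lt_const hε).filter_mono nhdsWithin_le_nhds
  obtain ⟨t, ht, htε⟩ := (hstrict.and hsmall).exists
  -- `y` satisfies the equalities at `p` and all inequalities strictly. Projecting it onto the
  -- affine subspace of equalities at `q` gives `w q → y`, so strictness survives.
  set y := x + t • d with hy
  have hyE : ∀ i ∈ E, ⟪y, g i p⟫_ℝ = f i p := by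
    intro i hi
    rw [hy, inner_add_left, real_inner_smul_left, real_inner_comm (g i p) d, hdE i hi, hx.1 i hi]
    simp
  obtain ⟨c, hc, hcb⟩ := exists_eventually_coeffBound hgE hE
  have hex : ∀ q, ∃ w, CoeffBound c (fun i => g i q) E →
      (∀ i ∈ E, ⟪w, g i q⟫_ℝ = f i q) ∧ ‖y - w‖ ≤ 2 * ((‖y‖ + 1) / c + 0) *
        ∑ i ∈ E, (‖g i p - g i q‖ + |f i p - f i q|) := by
    intro q
    by_cases hq : CoeffBound c (fun i => g i q) E
    · obtain ⟨m, w, hw, hwE⟩ := exists_gram_solution (hq.linearIndepOn hc) (fun i => f i q) y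
      have hle : ∀ i ∈ E, ‖g i p - g i q‖ + |f i p - f i q| ≤
          ∑ i ∈ E, (‖g i p - g i q‖ + |f i p - f i q|) := fun i hi =>
        Finset.single_le_sum (f := fun i => ‖g i p - g i q‖ + |f i p - f i q|)
          (fun _ _ => by positivity) hi
      -- At `p` the point `y` is its own projection, hence the zero multiplier and `M = 0`.
      exact ⟨w, fun _ => ⟨hwE, (norm_sub_le_of_common_support (g₁ := fun i => g i p)
        (f₁ := fun i => f i p) (l := 0) hc (norm_nonneg y)
        le_rfl hq (fun i hi => (le_add_of_nonneg_right (abs_nonneg _)).trans (hle i hi))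
        (fun i hi => (le_add_of_nonneg_left (norm_nonneg _)).trans (hle i hi))
        (Finset.sum_nonneg fun _ _ => by positivity) (by simp) le_rfl (by simp) hw hyE hwE).1⟩⟩
    · exact ⟨0, fun h => absurd h hq⟩
  choose w hw using hex
  have hwlim : Filter.Tendsto w (𝓝 p) (𝓝 y) := by
    rw [tendsto_iff_norm_sub_tendsto_zero]
    have h0 : Filter.Tendsto (fun q => 2 * ((‖y‖ + 1) / c + 0) *
        ∑ i ∈ E, (‖g i p - g i q‖ + |f i p - f i q|)) (𝓝 p) (𝓝 0) := by
      have h1 : Filter.Tendsto (fun q => ∑ i ∈ E, (‖g i p - g i q‖ + |f i p - f i q|)) (𝓝 p)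
          (𝓝 (∑ i ∈ E, (‖g i p - g i p‖ + |f i p - f i p|))) :=
        tendsto_finsetSum E fun i hi => ((tendsto_const_nhds.sub (hgE i hi)).norm).add
          ((tendsto_const_nhds.sub (hfE i hi)).abs)
      simpa using h1.const_mul (2 * ((‖y‖ + 1) / c + 0))
    refine squeeze_zero' (Filter.Eventually.of_forall fun q => norm_nonneg _) ?_ h0
    filter_upwards [hcb] with q hq
    rw [norm_sub_rev]
    exact (hw q hq).2
  have hwI : ∀ᶠ q in 𝓝 p, ∀ i ∈ I, ⟪w q, g i q⟫_ℝ < f i q :=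
    (Filter.eventually_all_finset I).2 fun i hi =>
      (hwlim.inner (hgI i hi)).eventually_lt (hfI i hi) (ht i hi)
  have hwε : ∀ᶠ q in 𝓝 p, ‖w q - x‖ < ε :=
    ((hwlim.sub_const x).norm).eventually_lt_const htε
  filter_upwards [hcb, hwI, hwε] with q h1 h2 h3
  exact ⟨w q, ⟨(hw q h1).1, fun i hi => (h2 i hi).le⟩, h3⟩

/-- Continuity of the projection at a point with a multiplier. -/
theorem tendsto_proj_feasibleSet [CompleteSpace H] [TopologicalSpace X] {g : ι → X → H}
    {f : ι → X → ℝ} {E I J : Finset ι} {p : X} {v x : H} {lam : ι → ℝ}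
    (hg : ∀ i ∈ J, ContinuousAt (g i) p) (hf : ∀ i ∈ J, ContinuousAt (f i) p)
    (hJ : ∀ i ∈ J, ⟪x, g i p⟫_ℝ = f i p) (hlam : ∀ i ∈ J, i ∉ E → i ∈ I ∧ 0 ≤ lam i)
    (hsum : v - x = ∑ i ∈ J, lam i • g i p)
    (hfeas : ∀ ε > 0, ∀ᶠ q in 𝓝 p, ∃ y ∈ feasibleSet g f E I q, ‖y - x‖ < ε) :
    Filter.Tendsto (fun z : H × X => proj (feasibleSet g f E I z.2) z.1) (𝓝 (v, p)) (𝓝 x) := by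
  have hproj : ∀ q, (feasibleSet g f E I q).Nonempty → ∀ u,
      IsNearest (feasibleSet g f E I q) u (proj (feasibleSet g f E I q) u) := fun q hq u =>
    isNearest_proj (convex_polyhedron (fun i => g i q) (fun i => f i q) E I)
      (isClosed_polyhedron (fun i => g i q) (fun i => f i q) E I) hq u
  set y : X → H := fun q => proj (feasibleSet g f E I q) x with hy
  have hylim : Filter.Tendsto y (𝓝 p) (𝓝 x) := by
    rw [Metric.tendsto_nhds]
    intro ε hε
    filter_upwards [hfeas ε hε] with q ⟨z, hz, hzx⟩
    rw [dist_comm, dist_eq_norm]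
    rw [norm_sub_rev] at hzx
    exact ((hproj q ⟨z, hz⟩ x).norm_sub_le_of_mem hz).trans_lt hzx
  have hne : ∀ᶠ q in 𝓝 p, (feasibleSet g f E I q).Nonempty := by
    filter_upwards [hfeas 1 one_pos] with q ⟨z, hz, _⟩
    exact ⟨z, hz⟩
  -- `B` bounds `‖P - x‖² = ‖P - v‖² - ‖v - x‖² + 2⟪v - x, P - x⟫`. The first norm is compared
  -- through the feasible point `y z.2`; the inner product is expanded by the multiplier, whose sign
  -- discards the slack of `P`.
  let B : H × X → ℝ := fun z => (‖v - x‖ + 2 * ‖z.1 - v‖ + ‖y z.2 - x‖) ^ 2 - ‖v - x‖ ^ 2 +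
    2 * ∑ i ∈ J, |lam i| * ((‖z.1‖ + ‖z.1 - y z.2‖) * ‖g i p - g i z.2‖ + |f i z.2 - f i p|)
  have h1 : Filter.Tendsto (fun z : H × X => z.1) (𝓝 (v, p)) (𝓝 v) := continuous_fst.tendsto _
  have h2 : Filter.Tendsto (fun z : H × X => z.2) (𝓝 (v, p)) (𝓝 p) := continuous_snd.tendsto _
  have hB : Filter.Tendsto B (𝓝 (v, p)) (𝓝 0) := by
    have hy2 := hylim.comp h2
    have a1 := (((tendsto_const_nhds (x := ‖v - x‖)).add (((h1.sub_const v).norm).const_mul 2)).add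
      ((hy2.sub_const x).norm)).pow 2
    have a2 : Filter.Tendsto (fun z : H × X => ∑ i ∈ J, |lam i| *
        ((‖z.1‖ + ‖z.1 - y z.2‖) * ‖g i p - g i z.2‖ + |f i z.2 - f i p|)) (𝓝 (v, p))
        (𝓝 (∑ i ∈ J, |lam i| * ((‖v‖ + ‖v - x‖) * ‖g i p - g i p‖ + |f i p - f i p|))) :=
      tendsto_finsetSum J fun i hi => Filter.Tendsto.const_mul _
        (((h1.norm.add (h1.sub hy2).norm).mul
          (tendsto_const_nhds.sub ((hg i hi).tendsto.comp h2)).norm).add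
          ((((hf i hi).tendsto.comp h2).sub_const _).abs))
    have a3 := (a1.sub_const (‖v - x‖ ^ 2)).add (a2.const_mul 2)
    simpa [B, Function.comp_def] using a3
  have hbound : ∀ᶠ z in 𝓝 (v, p), ‖proj (feasibleSet g f E I z.2) z.1 - x‖ ^ 2 ≤ B z := by
    filter_upwards [h2.eventually hne] with z hz
    have hP := hproj z.2 hz z.1
    have hyz := (hproj z.2 hz x).1
    set P := proj (feasibleSet g f E I z.2) z.1
    have b1 : ‖z.1 - P‖ ≤ ‖z.1 - y z.2‖ := hP.norm_sub_le_of_mem hyz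
    have b2 : ‖P‖ ≤ ‖z.1‖ + ‖z.1 - y z.2‖ := by
      have := norm_sub_norm_le P z.1
      rw [norm_sub_rev] at this
      linarith
    have b3 : ‖P - v‖ ≤ ‖v - x‖ + 2 * ‖z.1 - v‖ + ‖y z.2 - x‖ := by
      have c1 := norm_sub_le_norm_sub_add_norm_sub P z.1 v
      have c2 := norm_sub_le_norm_sub_add_norm_sub z.1 v (y z.2)
      have c3 := norm_sub_le_norm_sub_add_norm_sub v x (y z.2)
      rw [norm_sub_rev P z.1] at c1
      rw [norm_sub_rev x (y z.2)] at c3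
      linarith
    have b4 : ⟪v - x, P - x⟫_ℝ ≤ ∑ i ∈ J, |lam i| *
        ((‖z.1‖ + ‖z.1 - y z.2‖) * ‖g i p - g i z.2‖ + |f i z.2 - f i p|) := by
      rw [hsum, sum_inner]
      refine Finset.sum_le_sum fun i hi => ?_
      have e : ⟪g i p, P - x⟫_ℝ = ⟪P, g i p - g i z.2⟫_ℝ + (f i z.2 - f i p) +
          (⟪P, g i z.2⟫_ℝ - f i z.2) := by
        rw [inner_sub_right, real_inner_comm, real_inner_comm x, hJ i hi, inner_sub_right]
        ring
      have d1 : lam i * (⟪P, g i z.2⟫_ℝ - f i z.2) ≤ 0 := by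
        by_cases hE : i ∈ E
        · rw [hP.1.1 i hE]; simp
        · obtain ⟨hI, h0⟩ := hlam i hi hE
          exact mul_nonpos_of_nonneg_of_nonpos h0 (by linarith [hP.1.2 i hI])
      have d2 : |⟪P, g i p - g i z.2⟫_ℝ + (f i z.2 - f i p)| ≤
          (‖z.1‖ + ‖z.1 - y z.2‖) * ‖g i p - g i z.2‖ + |f i z.2 - f i p| :=
        (abs_add_le _ _).trans (add_le_add ((abs_real_inner_le_norm _ _).trans
          (mul_le_mul_of_nonneg_right b2 (norm_nonneg _))) le_rfl)
      have d3 := (le_abs_self _).trans (abs_mul (lam i)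
        (⟪P, g i p - g i z.2⟫_ℝ + (f i z.2 - f i p))).le
      have d4 := mul_le_mul_of_nonneg_left d2 (abs_nonneg (lam i))
      rw [real_inner_smul_left, e, mul_add]
      linarith
    have b5 : ‖P - v‖ ^ 2 = ‖P - x‖ ^ 2 - 2 * ⟪v - x, P - x⟫_ℝ + ‖v - x‖ ^ 2 := by
      rw [real_inner_comm, ← norm_sub_sq_real]; congr 2; abel
    have b6 := pow_le_pow_left₀ (norm_nonneg _) b3 2
    simp only [B]
    linarith
  rw [tendsto_iff_norm_sub_tendsto_zero]
  have hsq := squeeze_zero' (Filter.Eventually.of_forall fun z => sq_nonneg _) hbound hB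
  have := (Real.continuous_sqrt.tendsto 0).comp hsq
  simpa [Function.comp_def, Real.sqrt_sq (norm_nonneg _)] using this

end Local

end ParamProj

/-! ### Assembly: active constraints, uniform constants and the splitting -/

theorem mainTheorem11
    {G H ι : Type*} [NormedAddCommGroup G] [NormedSpace ℝ G]
    [NormedAddCommGroup H] [InnerProductSpace ℝ H] [CompleteSpace H] [DecidableEq ι]
    (D : Set G) (I₁ I₂ : Finset ι) (hI : Disjoint I₁ I₂) (hne : (I₁ ∪ I₂).Nonempty)
    (g : ι → D → H) (f : ι → D → ℝ)
    (hg : ∀ i ∈ I₁ ∪ I₂, LocallyLipschitz (g i)) (hf : ∀ i ∈ I₁ ∪ I₂, LocallyLipschitz (f i))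
    (pbar : D) (vbar xbar : H)
    (hCne : (ParamProj.feasibleSet g f I₁ I₂ pbar).Nonempty)
    (hv : vbar ∉ ParamProj.feasibleSet g f I₁ I₂ pbar)
    (hx : xbar = ParamProj.proj (ParamProj.feasibleSet g f I₁ I₂ pbar) vbar)
    (K : Finset ι) (hK : (K : Set ι) ⊆ ParamProj.activeSet g f I₁ I₂ pbar xbar ∩ (I₂ : Set ι))
    (lam : ι → ℝ) (hlam : ∀ i ∈ K, 0 < lam i)
    (hrep : vbar - xbar = ∑ i ∈ I₁ ∪ K, lam i • g i pbar)
    (hli : LinearIndepOn ℝ (fun i => g i pbar) ((I₁ ∪ K : Finset ι) : Set ι))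
    (hRCRCQ : ParamProj.RCRCQ g f I₁ I₂ pbar xbar)
    (hMFCQ : ∀ L : Finset ι,
      (L : Set ι) ⊆ (ParamProj.activeSet g f I₁ I₂ pbar xbar ∩ (I₂ : Set ι)) \ (K : Set ι) →
      LinearIndepOn ℝ (fun i => g i pbar) ((I₁ ∪ K ∪ L : Finset ι) : Set ι) →
      ParamProj.MFCQ g f (I₁ ∪ K ∪ L) (I₂ \ (K ∪ L)) pbar xbar) :
    ∃ W ∈ 𝓝 vbar, ∃ U ∈ 𝓝 pbar, ∃ ℓ : ℝ, 0 < ℓ ∧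
      (∀ p ∈ U, (ParamProj.feasibleSet g f I₁ I₂ p).Nonempty) ∧
      ∀ v₁ ∈ W, ∀ v₂ ∈ W, ∀ p₁ ∈ U, ∀ p₂ ∈ U,
        ‖(v₁ - v₂) - (2 : ℝ) • (ParamProj.proj (ParamProj.feasibleSet g f I₁ I₂ p₁) v₁ -
            ParamProj.proj (ParamProj.feasibleSet g f I₁ I₂ p₂) v₂)‖ ≤
          ‖v₁ - v₂‖ + ℓ * ‖(p₁ : G) - (p₂ : G)‖ := by
  classical
  set A : Finset ι := I₂.filter fun i => ⟪xbar, g i pbar⟫_ℝ = f i pbar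
  have hAI : A ⊆ I₂ := Finset.filter_subset _ _
  have hE₂ : ∀ i ∈ I₂, i ∈ I₁ ∪ I₂ := fun i hi => Finset.mem_union_right _ hi
  have hIA : I₁ ∪ A ⊆ I₁ ∪ I₂ := Finset.union_subset_union_right hAI
  have hgc : ∀ i ∈ I₁ ∪ I₂, ContinuousAt (g i) pbar := fun i hi => (hg i hi).continuous.continuousAt
  have hfc : ∀ i ∈ I₁ ∪ I₂, ContinuousAt (f i) pbar := fun i hi => (hf i hi).continuous.continuousAt
  obtain ⟨hxC, U₀, hU₀, hrank⟩ := hRCRCQ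
  have hKI : ∀ i ∈ K, i ∈ I₂ := fun i hi => (hK hi).2
  have hIK : I₁ ∪ K ⊆ I₁ ∪ I₂ := Finset.union_subset_union_right hKI
  have hactK : ∀ i ∈ I₁ ∪ K, ⟪xbar, g i pbar⟫_ℝ = f i pbar := by
    intro i hi
    rcases Finset.mem_union.1 hi with h | h
    exacts [hxC.1 i h, (hK h).1.2]
  -- nearby feasible points
  have hfeas : ∀ ε > 0, ∀ᶠ q in 𝓝 pbar,
      ∃ y ∈ ParamProj.feasibleSet g f I₁ I₂ q, ‖y - xbar‖ < ε := by
    intro ε hε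
    have hM := hMFCQ ∅ (by simp) (by simpa using hli)
    rw [Finset.union_empty, Finset.union_empty] at hM
    have hsd : I₂ \ K ⊆ I₁ ∪ I₂ := Finset.sdiff_subset.trans Finset.subset_union_right
    filter_upwards [hM.eventually_exists_feasible (fun i hi => hgc i (hIK hi))
      (fun i hi => hgc i (hsd hi)) (fun i hi => hfc i (hIK hi)) (fun i hi => hfc i (hsd hi)) hε]
      with q ⟨y, hy, hyx⟩
    -- Turning the constraints in `K` into equalities only shrinks the set, so these points are
    -- feasible for the original system.
    refine ⟨y, ⟨fun i hi => hy.1 i (Finset.mem_union_left _ hi), fun i hi => ?_⟩, hyx⟩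
    by_cases hiK : i ∈ K
    · exact (hy.1 i (Finset.mem_union_right _ hiK)).le
    · exact hy.2 i (Finset.mem_sdiff.2 ⟨hi, hiK⟩)
  have hlim := ParamProj.tendsto_proj_feasibleSet (E := I₁) (I := I₂)
    (fun i hi => hgc i (hIK hi)) (fun i hi => hfc i (hIK hi))
    hactK (fun i hi hiE => by
      have hiK := (Finset.mem_union.1 hi).resolve_left hiE
      exact ⟨hKI i hiK, (hlam i hiK).le⟩) hrep hfeas
  set P : H × D → H := fun z => ParamProj.proj (ParamProj.feasibleSet g f I₁ I₂ z.2) z.1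
  have hfst : Filter.Tendsto (fun z : H × D => z.1) (𝓝 (vbar, pbar)) (𝓝 vbar) :=
    continuous_fst.tendsto _
  have hsnd : Filter.Tendsto (fun z : H × D => z.2) (𝓝 (vbar, pbar)) (𝓝 pbar) :=
    continuous_snd.tendsto _
  -- uniform independence
  let F : Finset (Finset ι) := (I₁ ∪ A).powerset.filter fun J =>
    LinearIndepOn ℝ (fun i => g i pbar) (J : Set ι)
  have hF : ∀ J, J ∈ F ↔ J ⊆ I₁ ∪ A ∧ LinearIndepOn ℝ (fun i => g i pbar) (J : Set ι) := fun J => by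
    rw [Finset.mem_filter, Finset.mem_powerset]
  obtain ⟨c, hc, hcb⟩ := ParamProj.exists_eventually_forall_coeffBound F
    (fun J hJ i hi => hgc i (hIA (((hF J).1 hJ).1 hi))) fun J hJ => ((hF J).1 hJ).2
  -- RCRCQ transfers independence from `q` back to `pbar`, placing `J` in the finite list `F` on
  -- which `c` is uniform.
  have hmemF : ∀ q ∈ U₀, ∀ J, I₁ ⊆ J → J ⊆ I₁ ∪ A →
      LinearIndepOn ℝ (fun i => g i q) (J : Set ι) → J ∈ F := by
    intro q hq J hJ₁ hJ₂ hJ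
    refine (hF J).2 ⟨hJ₂, ParamProj.linearIndepOn_of_finrank_eq hJ (hrank J hJ₁ ?_ q hq)⟩
    intro i hi
    rcases Finset.mem_union.1 (hJ₂ hi) with h | h
    exacts [⟨Or.inl h, hxC.1 i h⟩, ⟨Or.inr (hAI h), (Finset.mem_filter.1 h).2⟩]
  have hI₁F : I₁ ∈ F := (hF I₁).2 ⟨Finset.subset_union_left,
    hli.mono (Finset.coe_subset.2 Finset.subset_union_left)⟩
  -- Lipschitz data
  obtain ⟨Lg, hLg, Ug, hUg, hgL⟩ := ParamProj.exists_eventually_forall_dist_le hg pbar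
  obtain ⟨Lf, hLf, Uf, hUf, hfL⟩ := ParamProj.exists_eventually_forall_dist_le hf pbar
  -- bounds
  let R : ℝ := ‖xbar‖ + 1 + (‖vbar - xbar‖ + 1) + ∑ i ∈ I₁ ∪ I₂, (‖g i pbar‖ + 1)
  have hS : 0 ≤ ∑ i ∈ I₁ ∪ I₂, (‖g i pbar‖ + 1) := Finset.sum_nonneg fun _ _ => by positivity
  have hR : 0 ≤ R := by positivity
  have hgR : ∀ᶠ q in 𝓝 pbar, ∀ i ∈ I₁ ∪ I₂, ‖g i q‖ ≤ R := by
    refine (Filter.eventually_all_finset _).2 fun i hi => ?_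
    filter_upwards [(hgc i hi).norm.eventually_lt_const (lt_add_one ‖g i pbar‖)] with q hq
    have : ‖g i pbar‖ + 1 ≤ ∑ i ∈ I₁ ∪ I₂, (‖g i pbar‖ + 1) :=
      Finset.single_le_sum (f := fun i => ‖g i pbar‖ + 1) (fun _ _ => by positivity) hi
    simp only [R]
    linarith [norm_nonneg xbar, norm_nonneg (vbar - xbar)]
  have hPR : ∀ᶠ z in 𝓝 (vbar, pbar), ‖P z‖ ≤ R := by
    filter_upwards [hlim.norm.eventually_lt_const (lt_add_one ‖xbar‖)] with z hz
    simp only [R]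
    linarith [norm_nonneg (vbar - xbar)]
  have hvR : ∀ᶠ z in 𝓝 (vbar, pbar), ‖z.1 - P z‖ ≤ R := by
    filter_upwards [(hfst.sub hlim).norm.eventually_lt_const (lt_add_one ‖vbar - xbar‖)] with z hz
    simp only [R]
    linarith [norm_nonneg xbar]
  have hinact : ∀ᶠ z in 𝓝 (vbar, pbar), ∀ i ∈ I₂ \ A, ⟪P z, g i z.2⟫_ℝ < f i z.2 := by
    refine (Filter.eventually_all_finset _).2 fun i hi => ?_
    obtain ⟨hi₂, hiA⟩ := Finset.mem_sdiff.1 hi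
    have hlt : ⟪xbar, g i pbar⟫_ℝ < f i pbar := lt_of_le_of_ne (hxC.2 i hi₂) fun h =>
      hiA (Finset.mem_filter.2 ⟨hi₂, h⟩)
    exact (hlim.inner ((hgc i (hE₂ i hi₂)).tendsto.comp hsnd)).eventually_lt
      ((hfc i (hE₂ i hi₂)).tendsto.comp hsnd) hlt
  have hne' : ∀ᶠ q in 𝓝 pbar, (ParamProj.feasibleSet g f I₁ I₂ q).Nonempty := by
    filter_upwards [hfeas 1 one_pos] with q ⟨y, hy, _⟩
    exact ⟨y, hy⟩
  have hparam : ∀ᶠ q in 𝓝 pbar, (ParamProj.feasibleSet g f I₁ I₂ q).Nonempty ∧ q ∈ U₀ ∧ q ∈ Ug ∧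
      q ∈ Uf ∧ (∀ J ∈ F, ParamProj.CoeffBound c (fun i => g i q) J) ∧
      ∀ i ∈ I₁ ∪ I₂, ‖g i q‖ ≤ R := by
    filter_upwards [hne', hU₀, hUg, hUf, hcb, hgR] with q h1 h2 h3 h4 h5 h6
    exact ⟨h1, h2, h3, h4, h5, h6⟩
  have hloc := hPR.and (hvR.and hinact)
  obtain ⟨W, hW, U₁, hU₁, hWU⟩ := mem_nhds_prod_iff.1 hloc
  obtain ⟨U₂, hU₂, hU₂p⟩ := Filter.eventually_iff_exists_mem.1 hparam
  have hpoint : ∀ v ∈ W, ∀ q ∈ U₁ ∩ U₂,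
      ParamProj.IsNearest (ParamProj.feasibleSet g f I₁ I₂ q) v (P (v, q)) ∧
      ParamProj.IsNearest (ParamProj.polyhedron (fun i => g i q) (fun i => f i q) I₁ A) v
        (P (v, q)) := by
    intro v hv q hq
    obtain ⟨hqne, -, -, -, hqF, -⟩ := hU₂p q hq.2
    obtain ⟨-, -, hqA⟩ := hWU (Set.mk_mem_prod hv hq.1)
    have hn : ParamProj.IsNearest
        (ParamProj.polyhedron (fun i => g i q) (fun i => f i q) I₁ I₂) v (P (v, q)) :=
      ParamProj.isNearest_proj (ParamProj.convex_polyhedron _ _ _ _)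
        (ParamProj.isClosed_polyhedron _ _ _ _) hqne v
    refine ⟨hn, ?_⟩
    -- The support `J` consists of constraints active at `P (v, q)`, hence avoids `I₂ \ A`; the same
    -- multiplier certifies the projection onto the larger polyhedron with only `A` kept.
    obtain ⟨J, l, hJ⟩ := hn.exists_isKKT ((hqF I₁ hI₁F).linearIndepOn hc)
    refine ParamProj.isNearest_of_multiplier ⟨hn.1.1, fun i hi => hn.1.2 i (hAI hi)⟩ hJ.active
      (fun i hi hiE => ⟨?_, hJ.nonneg i hi hiE⟩) hJ.sum_eq
    by_contra hiA
    exact (hqA i (Finset.mem_sdiff.2 ⟨hJ.mem_of_notMem i hi hiE, hiA⟩)).ne (hJ.active i hi)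
  have hC := ParamProj.dataConst_nonneg hc hR
  refine ⟨W, hW, U₁ ∩ U₂, Filter.inter_mem hU₁ hU₂,
    -- The factor `2` comes from the reflection; the `+ 1` only ensures strict positivity.
    2 * (ParamProj.dataConst c R * (Lg + Lf)) + 1, by positivity,
    fun p hp => (hU₂p p hp.2).1, ?_⟩
  intro v₁ hv₁ v₂ hv₂ p₁ hp₁ p₂ hp₂
  obtain ⟨-, hq₁, hg₁, hf₁, hF₁, -⟩ := hU₂p p₁ hp₁.2
  obtain ⟨-, hq₂, hg₂, hf₂, hF₂, hR₂⟩ := hU₂p p₂ hp₂.2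
  obtain ⟨hb₁, hb₂, -⟩ := hWU (Set.mk_mem_prod hv₂ hp₁.1)
  have hdist : dist p₁ p₂ = ‖(p₁ : G) - (p₂ : G)‖ := by
    rw [Subtype.dist_eq, dist_eq_norm]
  set δ := ‖(p₁ : G) - (p₂ : G)‖
  have hδ : 0 ≤ δ := norm_nonneg _
  have hdata : ‖P (v₂, p₁) - P (v₂, p₂)‖ ≤ ParamProj.dataConst c R * ((Lg + Lf) * δ) := by
    refine ParamProj.norm_sub_le_of_data_perturbation hc hR (by positivity)
      ((hF₁ I₁ hI₁F).linearIndepOn hc) ((hF₂ I₁ hI₁F).linearIndepOn hc)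
      (fun J hJ hJA hJl => ?_) (fun J hJ hJA hJl => hF₂ J (hmemF p₂ hq₂ J hJ hJA hJl))
      (fun i hi => ?_) (fun i hi => ?_) (fun i hi => hR₂ i (hIA hi)) hb₁ hb₂
      (hpoint v₂ hv₂ p₁ hp₁).2 (hpoint v₂ hv₂ p₂ hp₂).2
    · have := hmemF p₁ hq₁ J hJ hJA hJl
      exact ⟨hF₁ J this, hF₂ J this⟩
    · have := hgL i (hIA hi) p₁ hg₁ p₂ hg₂
      rw [dist_eq_norm, hdist] at this
      exact this.trans (mul_le_mul_of_nonneg_right (le_add_of_nonneg_right hLf) hδ)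
    · have := hfL i (hIA hi) p₁ hf₁ p₂ hf₂
      rw [Real.dist_eq, hdist] at this
      exact this.trans (mul_le_mul_of_nonneg_right (le_add_of_nonneg_left hLg) hδ)
  have hrefl := (hpoint v₁ hv₁ p₁ hp₁).1.norm_reflection_le (hpoint v₂ hv₂ p₁ hp₁).1
  change ‖(v₁ - v₂) - (2 : ℝ) • (P (v₁, p₁) - P (v₂, p₂))‖ ≤ _
  have e : (v₁ - v₂) - (2 : ℝ) • (P (v₁, p₁) - P (v₂, p₂)) =
      ((v₁ - v₂) - (2 : ℝ) • (P (v₁, p₁) - P (v₂, p₁))) -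
        (2 : ℝ) • (P (v₂, p₁) - P (v₂, p₂)) := by
    simp only [smul_sub]; abel
  rw [e]
  refine (norm_sub_le _ _).trans ?_
  rw [norm_smul, Real.norm_ofNat]
  linarith
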